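/- For $0\le y\le \sqrt{15}/2$ let $s(y)=\sqrt{-16y^4+56y^2+15}$, $$y_3=\frac{8y^3+2y+s(y)}{4(4y^2+1)},\qquad x_3=\frac{4y^2+1+2y\,s(y)}{4(4y^2+1)},$$ and let $P_y=(q_1,\dots,q_5)$ be the planar pentagon with $q_1=(-\tfrac12,0)$, $q_2=(\tfrac12,0)$, $q_3=(x_3,y_3)$, $q_4=(0,y)$, $q_5=(-x_3,y_3)$. It is symmetric about the vertical axis and equilateral with side $1$; the $P_y$ are the (normalized) mirror-symmetric equilateral pentagons on branch A. Write $r_{i,j}=|q_i-q_j|$ and $\Delta_{i,j,k}=(q_i-q_j)\wedge(q_i-q_k)$. A pentagon is convex if its five points are in convex position (no point lies in the convex hull of the others), and concave otherwise. It is of - type A2 if it is concave, $\Delta_{1,3,4}<0$, $\Delta_{3,4,5}<0$, $r_{1,4}<1$ and $r_{3,5}>1$; - type A4 if it is convex, $\Delta_{1,3,4}>0$, $\Delta_{3,4,5}>0$, $r_{1,4}>1$ and $r_{3,5}>1$. For a real exponent $A\ge 2$ and masses $m_1,\dots,m_5>0$ with total mass $M$ and centre of mass $c=\frac1M\sum_i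 m_iq_i$, the configuration is central if there is a real $\lambda$ such that $$\lambda(q_i-c)=\sum_{j\ne i}\frac{m_j(q_i-q_j)}{r_{i,j}^A}\qquad\text{for all } i.$$ **Theorem 2.** Let $A\ge 2$ be real. 1. If a pentagon on branch A is a central configuration for some positive masses, then it is of type A2 or of type A4. 2. Type A4 does occur: some pentagon of type A4 on branch A is a central configuration for some positive masses. 3. There is exactly one central configuration of type A2 on branch A with positive masses: there is exactly one pentagon of type A2 on branch A that is a central configuration for some positive masses, and its masses are unique up to a common positive factor. -/

import Mathlib

/-- Five labelled points of the Euclidean plane; the labels `1, …, 5` are the indices `0, …, 4`. -/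
abbrev Config := Fin 5 → EuclideanSpace ℝ (Fin 2)

/-- The wedge product `u ∧ v` of two plane vectors. -/
def wedge (u v : EuclideanSpace ℝ (Fin 2)) : ℝ := u 0 * v 1 - u 1 * v 0

/-- The oriented area `Δ_{i,j,k} = (q_i - q_j) ∧ (q_i - q_k)`. -/
def orientedArea (q : Config) (i j k : Fin 5) : ℝ := wedge (q i - q j) (q i - q k)

/-- The centre of mass `c = (1/M) ∑ m_i q_i`, where `M = ∑ m_i`. -/
noncomputable def massCenter (m : Fin 5 → ℝ) (q : Config) : EuclideanSpace ℝ (Fin 2) :=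
  (∑ i, m i)⁻¹ • ∑ i, m i • q i

/-- `q` is a central configuration for the positive masses `m` and the real exponent `A`: the
points are distinct and, for some real `lam`, for every `i`,
`lam (q_i - c) = ∑_{j ≠ i} m_j (q_i - q_j) / r_{i,j}^A`. -/
def IsCentralConfiguration (A : ℝ) (m : Fin 5 → ℝ) (q : Config) : Prop :=
  (∀ i, 0 < m i) ∧ Function.Injective q ∧
    ∃ lam : ℝ, ∀ i, lam • (q i - massCenter m q) =
      ∑ j ∈ Finset.univ.erase i, (m j / dist (q i) (q j) ^ A) • (q i - q j)

/-- The ordinate `y_3` on branch A (positive choice of sign), as a function of `y = y_4`. -/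
noncomputable def branchY3 (y : ℝ) : ℝ :=
  (8 * y ^ 3 + 2 * y + Real.sqrt (-16 * y ^ 4 + 56 * y ^ 2 + 15)) / (4 * (4 * y ^ 2 + 1))

/-- The abscissa `x_3` on branch A (positive choice of sign), as a function of `y = y_4`. -/
noncomputable def branchX3 (y : ℝ) : ℝ :=
  (4 * y ^ 2 + 1 + 2 * y * Real.sqrt (-16 * y ^ 4 + 56 * y ^ 2 + 15)) / (4 * (4 * y ^ 2 + 1))

/-- The pentagon on branch A with parameter `y = y_4`. -/
noncomputable def branchPentagon (y : ℝ) : Config :=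
  ![!₂[-1 / 2, 0], !₂[1 / 2, 0], !₂[branchX3 y, branchY3 y], !₂[0, y],
    !₂[-branchX3 y, branchY3 y]]

/-- The normalized mirror-symmetric equilateral pentagons on branch A, with the convention
`y_4 ≥ 0`. The second condition says that the square roots above are real. -/
def IsBranchA (q : Config) : Prop :=
  ∃ y : ℝ, 0 ≤ y ∧ 0 ≤ -16 * y ^ 4 + 56 * y ^ 2 + 15 ∧ q = branchPentagon y

/-- The pentagon is convex: its five points are in convex position. -/
def IsConvexPentagon (q : Config) : Prop := ConvexIndependent ℝ q

/-- Sign type A2. -/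
def IsTypeA2 (q : Config) : Prop :=
  ¬ IsConvexPentagon q ∧ orientedArea q 0 2 3 < 0 ∧ orientedArea q 2 3 4 < 0 ∧
    dist (q 0) (q 3) < 1 ∧ 1 < dist (q 2) (q 4)

/-- Sign type A4. -/
def IsTypeA4 (q : Config) : Prop :=
  IsConvexPentagon q ∧ 0 < orientedArea q 0 2 3 ∧ 0 < orientedArea q 2 3 4 ∧
    1 < dist (q 0) (q 3) ∧ 1 < dist (q 2) (q 4)

/-!
# Symmetric equilateral pentagons as central configurations

With `t = 2 y` and `w = √((15 - t²) / (1 + t²))` branch A becomes rational: `x₃ = c / 2` with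
`c = (1 + t w) / 2`, `y₃ = (t + w) / 4`, and the diagonals satisfy `r_{0,3}² = (1 + t²) / 4`,
`r_{0,2}² = 1 + c` and `r_{2,4} = c`. In particular `r_{0,2} > 1` always, and the equations of
motion force the masses to be symmetric. They reduce (`massEquations_of_central`,
`central_of_massEquations`) to three linear equations for the masses, in which
`Z = 8 Δ_{0,2,3} = 2 t + (t² - 1) w` appears.

*Signs.* Positivity of the masses in two of these equations says that `Z` has the sign of
`r_{0,3} - 1` and that `r_{2,4} > 1` (`sign_dichotomy`). As `Δ_{2,3,4}` has the sign of `t - w`,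
which is that of `t² - 3` and of `r_{0,3} - 1`, the two possible signs are exactly the types A2 and
A4.

*Existence.* Elimination of the masses leaves one equation in `t` (`BranchEquation`), whose two
sides are compared at the ends of an interval: at one end `r_{2,4} = 1`, and at the other either
`r_{0,3} = 1` (type A4) or `r_{2,4}` is so large that the equation fails in the opposite direction
(type A2).

*Uniqueness for type A2.* Put `k = A / 2`, `R = (1 - r_{0,2}^{-A}) / (r_{0,3}^{-A} - 1)`,
`G = (1 - r_{2,4}^{-A}) / (1 - r_{0,2}^{-A})` and `l = 2 t c / (-Z)`. The equation is
`R / (2 l) + 2 G (1 + l) = 1`. It gives `G < 1 / 2`, and by convexity of `x ↦ x ^ k` this implies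
`c < 1.171` whatever `A ≥ 2` is (`lt_of_powRatio_lt_half`), so that `t` lies in the short interval
`(0.2679, 0.3715)`. There `G`, `l` and `R` increase with `t`, so only the factor `1 / l` of the
first summand decreases. Bernoulli's inequality bounds the first summand by `0.56`
(`first_summand_le`) and the slope of `G` with respect to `c` from below (`powRatio_slope`), both
uniformly in `A`, and crude bounds on the slopes of `c` and `Z` then exclude two solutions
(`not_lt_of_reducedFun`).
-/

/-! ### Coordinates on branch A -/

/-- The second parameter of branch A. With `t = 2 y`, the pentagon with parameter `y` is described
by the pair `(t, w)` on the curve `(1 + t²)(1 + w²) = 16`. -/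
noncomputable def branchW (t : ℝ) : ℝ := Real.sqrt ((15 - t ^ 2) / (1 + t ^ 2))

/-- The distance `r_{2,4}` (labels `0, …, 4`), equal to `2 x_3`. -/
noncomputable def branchC (t : ℝ) : ℝ := (1 + t * branchW t) / 2

/-- Eight times the oriented area `Δ_{0,2,3}`. -/
noncomputable def branchZ (t : ℝ) : ℝ := 2 * t + (t ^ 2 - 1) * branchW t

/-- `r_{0,3}^{-A}`, with `k = A / 2`. -/
noncomputable def alphaPow (k t : ℝ) : ℝ := ((1 + t ^ 2) / 4) ^ (-k)

/-- `r_{0,2}^{-A}`, with `k = A / 2`; here `r_{0,2}² = 1 + r_{2,4}`. -/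
noncomputable def betaPow (k c : ℝ) : ℝ := (1 + c) ^ (-k)

/-- `r_{2,4}^{-A}`, with `k = A / 2`. -/
noncomputable def gammaPow (k c : ℝ) : ℝ := (c ^ 2) ^ (-k)

lemma branchW_nonneg (t : ℝ) : 0 ≤ branchW t := Real.sqrt_nonneg _

lemma branchW_sq {t : ℝ} (ht : t ^ 2 ≤ 15) : branchW t ^ 2 * (1 + t ^ 2) = 15 - t ^ 2 := by
  have h1 : 0 < 1 + t ^ 2 := by positivity
  unfold branchW
  rw [Real.sq_sqrt (div_nonneg (by linarith) h1.le)]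
  field_simp

lemma branchZ_eq (t : ℝ) : branchZ t = t - branchW t + 2 * t * branchC t := by
  unfold branchZ branchC
  ring

lemma branchC_ge {t : ℝ} (ht : 0 ≤ t) : 1 / 2 ≤ branchC t := by
  have := mul_nonneg ht (branchW_nonneg t)
  unfold branchC
  linarith

lemma branchC_pos {t : ℝ} (ht : 0 ≤ t) : 0 < branchC t := by
  linarith [branchC_ge ht]

lemma sq_le_of_radicand_nonneg {y : ℝ} (h : 0 ≤ -16 * y ^ 4 + 56 * y ^ 2 + 15) :
    (2 * y) ^ 2 ≤ 15 := by
  nlinarith [sq_nonneg y]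

lemma sqrt_radicand {y : ℝ} :
    Real.sqrt (-16 * y ^ 4 + 56 * y ^ 2 + 15) = (1 + (2 * y) ^ 2) * branchW (2 * y) := by
  have h1 : 0 < 1 + (2 * y) ^ 2 := by positivity
  have h2 : -16 * y ^ 4 + 56 * y ^ 2 + 15
      = (1 + (2 * y) ^ 2) ^ 2 * ((15 - (2 * y) ^ 2) / (1 + (2 * y) ^ 2)) := by
    field_simp
    ring
  rw [h2, Real.sqrt_mul (by positivity), Real.sqrt_sq h1.le, branchW]

lemma branchX3_eq (y : ℝ) : branchX3 y = (1 + 2 * y * branchW (2 * y)) / 4 := by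
  have h1 : 4 * y ^ 2 + 1 ≠ 0 := by positivity
  rw [branchX3, sqrt_radicand]
  field_simp
  ring

lemma branchY3_eq (y : ℝ) : branchY3 y = (2 * y + branchW (2 * y)) / 4 := by
  have h1 : 4 * y ^ 2 + 1 ≠ 0 := by positivity
  rw [branchY3, sqrt_radicand]
  field_simp
  ring

/-- The pentagon of branch A in the coordinates `(t, w)`. -/
lemma branchPentagon_eq (t : ℝ) : branchPentagon (t / 2) =
    ![!₂[-1 / 2, 0], !₂[1 / 2, 0], !₂[branchC t / 2, (t + branchW t) / 4], !₂[0, t / 2],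
      !₂[-(branchC t / 2), (t + branchW t) / 4]] := by
  have h : 2 * (t / 2) = t := by ring
  have hx : branchX3 (t / 2) = branchC t / 2 := by
    rw [branchX3_eq, branchC, h]
    ring
  rw [branchPentagon, hx, branchY3_eq, h]

section Coordinates

variable (t : ℝ)

@[simp] lemma branchPentagon_00 : branchPentagon (t / 2) 0 0 = -1 / 2 := by
  simp [branchPentagon_eq]
@[simp] lemma branchPentagon_01 : branchPentagon (t / 2) 0 1 = 0 := by
  simp [branchPentagon_eq]
@[simp] lemma branchPentagon_10 : branchPentagon (t / 2) 1 0 = 1 / 2 := by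
  simp [branchPentagon_eq]
@[simp] lemma branchPentagon_11 : branchPentagon (t / 2) 1 1 = 0 := by
  simp [branchPentagon_eq]
@[simp] lemma branchPentagon_20 : branchPentagon (t / 2) 2 0 = branchC t / 2 := by
  simp [branchPentagon_eq]
@[simp] lemma branchPentagon_21 : branchPentagon (t / 2) 2 1 = (t + branchW t) / 4 := by
  simp [branchPentagon_eq]
@[simp] lemma branchPentagon_30 : branchPentagon (t / 2) 3 0 = 0 := by
  simp [branchPentagon_eq]
@[simp] lemma branchPentagon_31 : branchPentagon (t / 2) 3 1 = t / 2 := by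
  simp [branchPentagon_eq]
@[simp] lemma branchPentagon_40 : branchPentagon (t / 2) 4 0 = -(branchC t / 2) := by
  simp [branchPentagon_eq]
@[simp] lemma branchPentagon_41 : branchPentagon (t / 2) 4 1 = (t + branchW t) / 4 := by
  simp [branchPentagon_eq]

end Coordinates

/-! ### The equations for the masses -/

lemma inv_dist_rpow {u v : EuclideanSpace ℝ (Fin 2)} {z : ℝ}
    (h : (u 0 - v 0) ^ 2 + (u 1 - v 1) ^ 2 = z) (A : ℝ) :
    (dist u v ^ A)⁻¹ = z ^ (-(A / 2)) := by
  have hz : 0 ≤ z := by rw [← h]; positivity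
  rw [EuclideanSpace.dist_eq, Fin.sum_univ_two, Real.dist_eq, Real.dist_eq, sq_abs, sq_abs, h,
    Real.sqrt_eq_rpow, ← Real.rpow_mul hz, ← Real.rpow_neg hz]
  congr 1
  ring

/-- The matrix of the numbers `r_{i,j}^{-A}` of an equilateral pentagon with unit side, symmetric
about the axis through the vertex `3`; the diagonal entries are irrelevant and set to `0`. -/
def mutualMatrix (al be ga : ℝ) : Fin 5 → Fin 5 → ℝ :=
  ![![0, 1, be, al, 1], ![1, 0, 1, al, be], ![be, 1, 0, 1, ga], ![al, al, 1, 0, 1],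
    ![1, be, ga, 1, 0]]

lemma inv_dist_branchPentagon (A : ℝ) {t : ℝ} (ht : t ^ 2 ≤ 15) {i j : Fin 5} (hij : i ≠ j) :
    (dist (branchPentagon (t / 2) i) (branchPentagon (t / 2) j) ^ A)⁻¹ =
      mutualMatrix (alphaPow (A / 2) t) (betaPow (A / 2) (branchC t))
        (gammaPow (A / 2) (branchC t)) i j := by
  have hw := branchW_sq ht
  have hc : branchC t = (1 + t * branchW t) / 2 := rfl
  set w := branchW t with hwdef
  set P := branchPentagon (t / 2) with hP
  have one : ∀ {i j : Fin 5}, (P i 0 - P j 0) ^ 2 + (P i 1 - P j 1) ^ 2 = 1 →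
      (dist (P i) (P j) ^ A)⁻¹ = 1 := fun h ↦ by rw [inv_dist_rpow h, Real.one_rpow]
  have h01 : (dist (P 0) (P 1) ^ A)⁻¹ = 1 := one (by simp [hP]; norm_num)
  have h12 : (dist (P 1) (P 2) ^ A)⁻¹ = 1 := one (by
    simp [hP, hc, ← hwdef]; linear_combination (1 / 16) * hw)
  have h23 : (dist (P 2) (P 3) ^ A)⁻¹ = 1 := one (by
    simp [hP, hc, ← hwdef]; linear_combination (1 / 16) * hw)
  have h34 : (dist (P 3) (P 4) ^ A)⁻¹ = 1 := one (by
    simp [hP, hc, ← hwdef]; linear_combination (1 / 16) * hw)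
  have h04 : (dist (P 0) (P 4) ^ A)⁻¹ = 1 := one (by
    simp [hP, hc, ← hwdef]; linear_combination (1 / 16) * hw)
  have h03 : (dist (P 0) (P 3) ^ A)⁻¹ = alphaPow (A / 2) t :=
    inv_dist_rpow (by simp [hP]; ring) A
  have h13 : (dist (P 1) (P 3) ^ A)⁻¹ = alphaPow (A / 2) t :=
    inv_dist_rpow (by simp [hP]; ring) A
  have h02 : (dist (P 0) (P 2) ^ A)⁻¹ = betaPow (A / 2) (branchC t) :=
    inv_dist_rpow (by simp [hP, hc, ← hwdef]; linear_combination (1 / 16) * hw) A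
  have h14 : (dist (P 1) (P 4) ^ A)⁻¹ = betaPow (A / 2) (branchC t) :=
    inv_dist_rpow (by simp [hP, hc, ← hwdef]; linear_combination (1 / 16) * hw) A
  have h24 : (dist (P 2) (P 4) ^ A)⁻¹ = gammaPow (A / 2) (branchC t) :=
    inv_dist_rpow (by simp [hP]) A
  fin_cases i <;> fin_cases j <;> first
    | exact absurd rfl hij
    | (simp [mutualMatrix, h01, h12, h23, h34, h04, h03, h13, h02, h14, h24]; done)
    | (rw [dist_comm]; simp [mutualMatrix, h01, h12, h23, h34, h04, h03, h13, h02, h14, h24])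

/-- The equations of a central configuration, in coordinates and in terms of the pair `(t, w)`. -/
lemma central_equation_iff (A : ℝ) {t : ℝ} (ht : t ^ 2 ≤ 15) (m : Fin 5 → ℝ) (lam : ℝ)
    (C : EuclideanSpace ℝ (Fin 2)) (i : Fin 5) :
    lam • (branchPentagon (t / 2) i - C) =
        ∑ j ∈ Finset.univ.erase i,
          (m j / dist (branchPentagon (t / 2) i) (branchPentagon (t / 2) j) ^ A) •
            (branchPentagon (t / 2) i - branchPentagon (t / 2) j) ↔
      ∀ l : Fin 2, lam * (branchPentagon (t / 2) i l - C l) =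
        ∑ j, m j * mutualMatrix (alphaPow (A / 2) t) (betaPow (A / 2) (branchC t))
        (gammaPow (A / 2) (branchC t)) i j *
          (branchPentagon (t / 2) i l - branchPentagon (t / 2) j l) := by
  have key : ∑ j ∈ Finset.univ.erase i,
          (m j / dist (branchPentagon (t / 2) i) (branchPentagon (t / 2) j) ^ A) •
            (branchPentagon (t / 2) i - branchPentagon (t / 2) j) =
      ∑ j, (m j * mutualMatrix (alphaPow (A / 2) t) (betaPow (A / 2) (branchC t))
        (gammaPow (A / 2) (branchC t)) i j) •
          (branchPentagon (t / 2) i - branchPentagon (t / 2) j) := by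
    rw [← Finset.sum_erase (Finset.univ : Finset (Fin 5)) (a := i) (by simp)]
    refine Finset.sum_congr rfl fun j hj ↦ ?_
    rw [div_eq_mul_inv, inv_dist_branchPentagon A ht (Finset.ne_of_mem_erase hj).symm]
  rw [key, PiLp.ext_iff]
  simp

/-- The coordinates of the centre of mass. -/
lemma massCenter_apply (m : Fin 5 → ℝ) (q : Config) (l : Fin 2) :
    massCenter m q l = (∑ i, m i)⁻¹ * ∑ i, m i * q i l := by
  simp [massCenter]

/-- The linear equations satisfied by the masses of a central configuration on branch A: the masses
are symmetric, and three of the equations of Laura and Andoyer remain. They come from the pairs of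
vertices `{0, 2}`, `{0, 3}` and `{2, 3}`. -/
def MassEquations (t al be ga : ℝ) (m : Fin 5 → ℝ) : Prop :=
  m 0 = m 1 ∧ m 4 = m 2 ∧
    m 3 * ((1 - al) * branchZ t) = 2 * m 2 * ((1 - ga) * branchC t * (t + branchW t)) ∧
    4 * m 1 * ((1 - al) * t) = m 2 * ((1 - be) * branchZ t) ∧
    m 1 * (4 * t * branchC t * (1 - al) - (1 - be) * branchZ t) =
      2 * m 2 * ((1 - ga) * branchC t * (t - branchW t))

/-- Expanded form of the equation of motion of one vertex. -/
lemma central_equation_expand (t al be ga : ℝ) (m : Fin 5 → ℝ) (lam : ℝ)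
    (C : EuclideanSpace ℝ (Fin 2)) :
    (∀ i, ∀ l : Fin 2, lam * (branchPentagon (t / 2) i l - C l) =
        ∑ j, m j * mutualMatrix al be ga i j *
          (branchPentagon (t / 2) i l - branchPentagon (t / 2) j l)) ↔
    ((lam * (-1 / 2 - C 0) = -m 1 - m 2 * be * (1 / 2 + branchC t / 2) - m 3 * al / 2
        + m 4 * (-1 / 2 + branchC t / 2)) ∧
      (lam * (0 - C 1) = -m 2 * be * ((t + branchW t) / 4) - m 3 * al * (t / 2)
        - m 4 * ((t + branchW t) / 4))) ∧
    ((lam * (1 / 2 - C 0) = m 0 + m 2 * (1 / 2 - branchC t / 2) + m 3 * al / 2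
        + m 4 * be * (1 / 2 + branchC t / 2)) ∧
      (lam * (0 - C 1) = -m 2 * ((t + branchW t) / 4) - m 3 * al * (t / 2)
        - m 4 * be * ((t + branchW t) / 4))) ∧
    ((lam * (branchC t / 2 - C 0) = m 0 * be * (branchC t / 2 + 1 / 2)
        + m 1 * (branchC t / 2 - 1 / 2) + m 3 * (branchC t / 2) + m 4 * ga * branchC t) ∧
      (lam * ((t + branchW t) / 4 - C 1) = m 0 * be * ((t + branchW t) / 4)
        + m 1 * ((t + branchW t) / 4) + m 3 * ((branchW t - t) / 4))) ∧
    ((lam * (0 - C 0) = m 0 * al / 2 - m 1 * al / 2 - m 2 * (branchC t / 2)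
        + m 4 * (branchC t / 2)) ∧
      (lam * (t / 2 - C 1) = m 0 * al * (t / 2) + m 1 * al * (t / 2)
        - m 2 * ((branchW t - t) / 4) - m 4 * ((branchW t - t) / 4))) ∧
    ((lam * (-(branchC t / 2) - C 0) = m 0 * (1 / 2 - branchC t / 2)
        - m 1 * be * (branchC t / 2 + 1 / 2) - m 2 * ga * branchC t - m 3 * (branchC t / 2)) ∧
      (lam * ((t + branchW t) / 4 - C 1) = m 0 * ((t + branchW t) / 4)
        + m 1 * be * ((t + branchW t) / 4) + m 3 * ((branchW t - t) / 4))) := by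
  simp only [Fin.forall_fin_succ, Fin.sum_univ_five]
  simp [mutualMatrix]
  ring_nf

lemma massEquations_of_central {A : ℝ} (hA : 2 ≤ A) {t : ℝ} (ht0 : 0 ≤ t) (ht : t ^ 2 ≤ 15)
    {m : Fin 5 → ℝ} (h : IsCentralConfiguration A m (branchPentagon (t / 2))) :
    MassEquations t (alphaPow (A / 2) t) (betaPow (A / 2) (branchC t))
        (gammaPow (A / 2) (branchC t)) m := by
  obtain ⟨-, -, lam, hl⟩ := h
  have h := fun i ↦ (central_equation_iff A ht m lam _ i).1 (hl i)
  rw [central_equation_expand] at h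
  have hb : betaPow (A / 2) (branchC t) < 1 :=
    Real.rpow_lt_one_of_one_lt_of_neg (by linarith [branchC_pos ht0]) (by linarith)
  have hc := branchC_pos ht0
  have hZ := branchZ_eq t
  have hw := branchW_sq ht
  have hw0 := branchW_nonneg t
  set al := alphaPow (A / 2) t
  set be := betaPow (A / 2) (branchC t)
  set ga := gammaPow (A / 2) (branchC t)
  set C := massCenter m (branchPentagon (t / 2))
  set w := branchW t
  set c := branchC t
  have hs : 0 < t + w := by
    rcases ht0.eq_or_lt with rfl | h0
    · have : w ≠ 0 := by rintro h0; rw [h0] at hw; norm_num at hw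
      positivity
    · positivity
  obtain ⟨⟨e0x, e0y⟩, ⟨e1x, e1y⟩, ⟨e2x, e2y⟩, ⟨e3x, e3y⟩, ⟨e4x, e4y⟩⟩ := h
  have hb1 : (1 - be) ≠ 0 := by linarith
  have h42 : m 4 = m 2 := by
    have : (1 - be) * (t + w) * (m 4 - m 2) = 0 := by linear_combination 4 * (e0y - e1y)
    have := (mul_eq_zero.1 this).resolve_left (mul_ne_zero hb1 hs.ne')
    linarith
  have h01 : m 0 = m 1 := by
    have : (1 - be) * (t + w) * (m 0 - m 1) = 0 := by linear_combination 4 * (e2y - e4y)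
    have := (mul_eq_zero.1 this).resolve_left (mul_ne_zero hb1 hs.ne')
    linarith
  refine ⟨h01, h42, ?_, ?_, ?_⟩ <;> rw [hZ]
  · simp only [h42, h01] at e0x e0y e2x e2y
    linear_combination 2 * ((t + w) * (e0x - e2x) - 2 * (1 + c) * (e0y - e2y))
  · simp only [h42, h01] at e0x e0y e3x e3y
    linear_combination 4 * (t * (e0x - e3x) - (e0y - e3y))
  · simp only [h42, h01] at e2x e2y e3x e3y
    linear_combination 2 * ((w - t) * (e2x - e3x) - 2 * c * (e2y - e3y))

lemma branchPentagon_injective {t : ℝ} (ht0 : 0 < t) :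
    Function.Injective (branchPentagon (t / 2)) := by
  have hc := branchC_pos ht0.le
  have hw := branchW_nonneg t
  intro i j hij
  have h0 := congrArg (fun v : EuclideanSpace ℝ (Fin 2) ↦ v 0) hij
  have h1 := congrArg (fun v : EuclideanSpace ℝ (Fin 2) ↦ v 1) hij
  fin_cases i <;> fin_cases j <;> first
    | rfl
    | (exfalso; simp at h0; linarith)
    | (exfalso; simp at h1; linarith)

/-- Conversely, the three equations for symmetric masses suffice when `Δ_{0,2,3} ≠ 0`. With `lam`
chosen to satisfy the horizontal equation of the vertex `0`, the three equations force the vertical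
residuals of all vertices to agree and the horizontal ones to vanish; the common vertical residual
is zero because the total momentum is. -/
lemma central_of_massEquations {A : ℝ} {t : ℝ} (ht0 : 0 < t) (ht : t ^ 2 ≤ 15)
    (hZ0 : branchZ t ≠ 0) {m : Fin 5 → ℝ} (hm : ∀ i, 0 < m i)
    (h : MassEquations t (alphaPow (A / 2) t) (betaPow (A / 2) (branchC t))
        (gammaPow (A / 2) (branchC t)) m) :
    IsCentralConfiguration A m (branchPentagon (t / 2)) := by
  refine ⟨hm, branchPentagon_injective ht0,
    2 * m 1 + m 2 * ((1 + branchC t) * betaPow (A / 2) (branchC t)) + m 3 * alphaPow (A / 2) t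
      + m 2 * (1 - branchC t), fun i ↦ (central_equation_iff A ht m _ _ i).2 ?_⟩
  revert i
  rw [central_equation_expand]
  have hc := branchC_pos ht0.le
  have hZ := branchZ_eq t
  obtain ⟨h01, h42, E1, E2, E4⟩ := h
  have hM : 0 < 2 * m 1 + 2 * m 2 + m 3 := by linarith [hm 1, hm 2, hm 3]
  have hC0 : massCenter m (branchPentagon (t / 2)) 0 = 0 := by
    rw [massCenter_apply, Fin.sum_univ_five (fun i ↦ m i * _)]
    simp [h01, h42]
    right
    ring
  have hC1 : (2 * m 1 + 2 * m 2 + m 3) * massCenter m (branchPentagon (t / 2)) 1 =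
      m 2 * (t + branchW t) / 2 + m 3 * t / 2 := by
    have hs : ∑ i, m i = 2 * m 1 + 2 * m 2 + m 3 := by
      rw [Fin.sum_univ_five, h01, h42]
      ring
    rw [massCenter_apply, hs, mul_inv_cancel_left₀ hM.ne', Fin.sum_univ_five]
    simp [h01, h42]
    ring
  rw [hC0]
  set al := alphaPow (A / 2) t
  set be := betaPow (A / 2) (branchC t)
  set ga := gammaPow (A / 2) (branchC t)
  set C := massCenter m (branchPentagon (t / 2)) 1
  set w := branchW t
  set c := branchC t
  rw [h01, h42]
  rw [hZ] at E1 E2 E4 hZ0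
  generalize hlam : 2 * m 1 + m 2 * ((1 + c) * be) + m 3 * al + m 2 * (1 - c) = lam
  obtain ⟨a, ha⟩ : ∃ a, a = lam * (0 - C) - (-m 2 * be * ((t + w) / 4) - m 3 * al * (t / 2)
        - m 2 * ((t + w) / 4)) := ⟨_, rfl⟩
  obtain ⟨b, hb⟩ : ∃ b, b = lam * ((t + w) / 4 - C) - (m 1 * be * ((t + w) / 4)
        + m 1 * ((t + w) / 4) + m 3 * ((w - t) / 4)) := ⟨_, rfl⟩
  obtain ⟨e, he⟩ : ∃ e, e = lam * (c / 2) - (m 1 * be * (c / 2 + 1 / 2)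
        + m 1 * (c / 2 - 1 / 2) + m 3 * (c / 2) + m 2 * ga * c) := ⟨_, rfl⟩
  obtain ⟨d, hd⟩ : ∃ d, d = lam * (t / 2 - C) - (m 1 * al * (t / 2) + m 1 * al * (t / 2)
        - m 2 * ((w - t) / 4) - m 2 * ((w - t) / 4)) := ⟨_, rfl⟩
  have had : a = d := by
    rw [ha, hd, ← hlam]
    linear_combination (-1 / 4) * E2
  have hA : (t + w) * e + 2 * (1 + c) * (a - b) = 0 := by
    rw [ha, hb, he, ← hlam]
    linear_combination (-1 / 2) * E1
  have hB : (w - t) * e + 2 * c * (d - b) = 0 := by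
    rw [hd, hb, he, ← hlam]
    linear_combination (1 / 2) * E4
  have he0 : e = 0 := by
    have : (t - w + 2 * t * c) * e = 0 := by
      rw [← had] at hB
      linear_combination c * hA - (1 + c) * hB
    exact (mul_eq_zero.1 this).resolve_left hZ0
  have hab : a = b := by
    rw [he0] at hA
    have : 2 * (1 + c) * (a - b) = 0 := by linarith
    have := (mul_eq_zero.1 this).resolve_left (by positivity)
    linarith
  have ha0 : a = 0 := by
    have : (2 * m 1 + 2 * m 2 + m 3) * a = 0 := by
      have : 2 * m 1 * a + 2 * m 2 * b + m 3 * d = 0 := by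
        rw [ha, hb, hd]
        linear_combination (-lam) * hC1
      rw [← hab, ← had] at this
      linarith
    exact (mul_eq_zero.1 this).resolve_left hM.ne'
  rw [← hab] at hb
  rw [← had] at hd
  rw [ha0] at ha hb hd
  rw [he0] at he
  refine ⟨⟨?_, ?_⟩, ⟨?_, ?_⟩, ⟨?_, ?_⟩, ⟨?_, ?_⟩, ⟨?_, ?_⟩⟩ <;> linarith

/-! ### Elimination of the masses -/

/-- The condition left on `t` after the masses are eliminated from `MassEquations`. -/
def BranchEquation (k t : ℝ) : Prop :=
  (1 - betaPow k (branchC t)) * branchZ t *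
      (4 * t * branchC t * (1 - alphaPow k t) - (1 - betaPow k (branchC t)) * branchZ t) =
    8 * t * branchC t * (1 - alphaPow k t) * (1 - gammaPow k (branchC t)) * (t - branchW t)

lemma branchEquation_of_masses {k t : ℝ} {m : Fin 5 → ℝ} (hm : ∀ i, 0 < m i)
    (h : MassEquations t (alphaPow k t) (betaPow k (branchC t)) (gammaPow k (branchC t)) m) :
    BranchEquation k t := by
  obtain ⟨-, -, -, E2, E4⟩ := h
  have h0 : m 1 * m 2 ≠ 0 := (mul_pos (hm 1) (hm 2)).ne'
  refine mul_left_cancel₀ h0 ?_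
  linear_combination (-2 * m 2 * ((1 - gammaPow k (branchC t)) * branchC t * (t - branchW t))) * E2
    + (m 2 * ((1 - betaPow k (branchC t)) * branchZ t)) * E4

lemma exists_masses {k t : ℝ} (ht : 0 < t) (hb : betaPow k (branchC t) < 1)
    (hg : gammaPow k (branchC t) < 1) (ha : 0 < (1 - alphaPow k t) * branchZ t)
    (h : BranchEquation k t) :
    ∃ m : Fin 5 → ℝ, (∀ i, 0 < m i) ∧
      MassEquations t (alphaPow k t) (betaPow k (branchC t)) (gammaPow k (branchC t)) m := by
  have hc := branchC_pos ht.le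
  have hw := branchW_nonneg t
  unfold BranchEquation at h
  unfold MassEquations
  set al := alphaPow k t
  set be := betaPow k (branchC t)
  set ga := gammaPow k (branchC t)
  set w := branchW t
  set c := branchC t
  set Z := branchZ t
  have hp : 1 - al ≠ 0 := by rintro h0; simp [h0] at ha
  have hZ : Z ≠ 0 := by rintro h0; simp [h0] at ha
  have hZp : 0 < Z / (1 - al) := by
    have : Z / (1 - al) = (1 - al) * Z / (1 - al) ^ 2 := by field_simp
    rw [this]; positivity
  have h1 : 0 < (1 - be) * Z / (4 * (1 - al) * t) := by
    have : (1 - be) * Z / (4 * (1 - al) * t) = (1 - be) * (Z / (1 - al)) / (4 * t) := by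
      field_simp
    rw [this]
    have : 0 < 1 - be := by linarith
    positivity
  have h3 : 0 < 2 * (1 - ga) * c * (t + w) / ((1 - al) * Z) := by
    have : 0 < 1 - ga := by linarith
    positivity
  refine ⟨![(1 - be) * Z / (4 * (1 - al) * t), (1 - be) * Z / (4 * (1 - al) * t), 1,
    2 * (1 - ga) * c * (t + w) / ((1 - al) * Z), 1], ?_, ?_⟩
  · intro i
    fin_cases i <;> simp <;> assumption
  · refine ⟨rfl, rfl, ?_, ?_, ?_⟩
    · simp
      field_simp
    · simp
      field_simp
    · simp
      field_simp
      linear_combination h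

lemma masses_unique {t al be ga : ℝ} {m m' : Fin 5 → ℝ} (ht : 0 < t)
    (ha : (1 - al) * branchZ t ≠ 0) (hm : ∀ i, 0 < m i) (hm' : ∀ i, 0 < m' i)
    (h : MassEquations t al be ga m) (h' : MassEquations t al be ga m') :
    ∃ r : ℝ, 0 < r ∧ m' = r • m := by
  obtain ⟨h01, h42, E1, E2, -⟩ := h
  obtain ⟨h01', h42', E1', E2', -⟩ := h'
  have h2 := (hm 2).ne'
  have e2 : m' 2 = m' 2 / m 2 * m 2 := by field_simp
  have e3 : m' 3 = m' 2 / m 2 * m 3 := by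
    refine mul_right_cancel₀ ha ?_
    field_simp
    linear_combination m 2 * E1' - m' 2 * E1
  have e1 : m' 1 = m' 2 / m 2 * m 1 := by
    have : m' 1 * m 2 = m' 2 * m 1 := by
      refine mul_right_cancel₀ (mul_ne_zero (left_ne_zero_of_mul ha) ht.ne') ?_
      linear_combination (m 2 * E2' - m' 2 * E2) / 4
    field_simp
    linarith
  refine ⟨m' 2 / m 2, div_pos (hm' 2) (hm 2), ?_⟩
  funext i
  fin_cases i
  · simpa [h01, h01'] using e1
  · simpa using e1
  · simpa using e2
  · simpa using e3
  · simpa [h42, h42'] using e2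

/-! ### Signs -/

lemma lt_branchW {t a : ℝ} (ht : t ^ 2 ≤ 15) (h : a ^ 2 * (1 + t ^ 2) < 15 - t ^ 2) :
    a < branchW t := by
  rw [← branchW_sq ht] at h
  exact lt_of_pow_lt_pow_left₀ 2 (branchW_nonneg t) (lt_of_mul_lt_mul_right h (by positivity))

lemma branchW_lt {t a : ℝ} (ht : t ^ 2 ≤ 15) (ha : 0 ≤ a) (h : 15 - t ^ 2 < a ^ 2 * (1 + t ^ 2)) :
    branchW t < a := by
  rw [← branchW_sq ht] at h
  exact lt_of_pow_lt_pow_left₀ 2 ha (lt_of_mul_lt_mul_right h (by positivity))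

lemma branchW_eq {t a : ℝ} (ha : 0 ≤ a) (h : a ^ 2 * (1 + t ^ 2) = 15 - t ^ 2) :
    branchW t = a := by
  rw [branchW, ← h, mul_div_cancel_right₀ _ (by positivity), Real.sqrt_sq ha]

lemma alphaPow_gt_one {k t : ℝ} (hk : 0 < k) (h : t ^ 2 < 3) : 1 < alphaPow k t :=
  Real.one_lt_rpow_of_pos_of_lt_one_of_neg (by positivity) (by linarith) (by linarith)

lemma alphaPow_lt_one {k t : ℝ} (hk : 0 < k) (h : 3 < t ^ 2) : alphaPow k t < 1 :=
  Real.rpow_lt_one_of_one_lt_of_neg (by linarith) (by linarith)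

lemma betaPow_pos {k c : ℝ} (hc : 0 < c) : 0 < betaPow k c :=
  Real.rpow_pos_of_pos (by linarith) _

lemma betaPow_lt_one {k c : ℝ} (hk : 0 < k) (hc : 0 < c) : betaPow k c < 1 :=
  Real.rpow_lt_one_of_one_lt_of_neg (by linarith) (by linarith)

lemma gammaPow_lt_one {k c : ℝ} (hk : 0 < k) (hc : 1 < c) : gammaPow k c < 1 :=
  Real.rpow_lt_one_of_one_lt_of_neg (by nlinarith) (by linarith)

lemma one_lt_of_gammaPow_lt_one {k c : ℝ} (hk : 0 < k) (hc : 0 < c) (h : gammaPow k c < 1) :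
    1 < c := by
  by_contra! hc1
  have : 1 ≤ gammaPow k c :=
    Real.one_le_rpow_of_pos_of_le_one_of_nonpos (by positivity) (by nlinarith) (by linarith)
  linarith

/-- Positivity of the masses already fixes the signs of all relevant quantities: since
`r_{0,2} > 1`, the equations for the pairs `{0, 3}` and `{0, 2}` show that `Δ_{0,2,3}` has the sign
of `r_{0,3} - 1` and that `r_{2,4} > 1`. -/
lemma sign_dichotomy {k t : ℝ} (hk : 0 < k) (ht0 : 0 ≤ t) (ht : t ^ 2 ≤ 15) {m : Fin 5 → ℝ}
    (hm : ∀ i, 0 < m i)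
    (h : MassEquations t (alphaPow k t) (betaPow k (branchC t)) (gammaPow k (branchC t)) m) :
    0 < t ∧ 1 < branchC t ∧
      (t ^ 2 < 3 ∧ branchZ t < 0 ∨ 3 < t ^ 2 ∧ 0 < branchZ t) := by
  obtain ⟨-, -, E1, E2, -⟩ := h
  have hc := branchC_pos ht0
  have hw0 := branchW_nonneg t
  have hb : 0 < 1 - betaPow k (branchC t) := by linarith [betaPow_lt_one hk hc]
  have hm2b := mul_pos (hm 2) hb
  have ht1 : 0 < t := by
    rcases ht0.eq_or_lt with rfl | h0
    · exfalso
      have hw : branchW 0 ^ 2 * (1 + 0 ^ 2) = 15 - 0 ^ 2 := branchW_sq ht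
      have hZ : branchZ 0 = -branchW 0 := by simp [branchZ]
      rw [hZ] at E2
      have : m 2 * (1 - betaPow k (branchC 0)) * branchW 0 = 0 := by linear_combination E2
      have := (mul_eq_zero.1 this).resolve_left hm2b.ne'
      rw [this] at hw
      norm_num at hw
    · exact h0
  have hm1t := mul_pos (hm 1) ht1
  -- The sign of `Z` is that of `1 - al`, and then the sign of `1 - ga` is positive.
  have hga : 0 < (1 - alphaPow k t) * branchZ t → 1 < branchC t := fun hpZ ↦ by
    refine one_lt_of_gammaPow_lt_one hk hc ?_
    have h2 : 0 < 2 * m 2 * (branchC t * (t + branchW t)) := by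
      have := hm 2
      positivity
    have h3 : 0 < (2 * m 2 * (branchC t * (t + branchW t))) * (1 - gammaPow k (branchC t)) := by
      have := mul_pos (hm 3) hpZ
      rw [E1] at this
      linarith
    linarith [(mul_pos_iff_of_pos_left h2).1 h3]
  rcases lt_trichotomy (t ^ 2) 3 with h3 | h3 | h3
  · have hal := alphaPow_gt_one hk h3
    have hZ : branchZ t < 0 := by
      by_contra! hZ
      have h1 := mul_nonneg hm2b.le hZ
      have h2 := mul_pos hm1t (sub_pos.2 hal)
      linarith
    exact ⟨ht1, hga (mul_pos_of_neg_of_neg (by linarith) hZ), Or.inl ⟨h3, hZ⟩⟩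
  · exfalso
    have hal : alphaPow k t = 1 := by
      rw [alphaPow, h3]
      norm_num
    have hZ : 0 < branchZ t := by
      rw [branchZ, h3]
      linarith
    have := mul_pos hm2b hZ
    rw [hal] at E2
    linarith
  · have hal := alphaPow_lt_one hk h3
    have hZ : 0 < branchZ t := by
      rw [branchZ]
      nlinarith [mul_nonneg (by linarith : 0 ≤ t ^ 2 - 1) hw0]
    exact ⟨ht1, hga (mul_pos (by linarith) hZ), Or.inr ⟨h3, hZ⟩⟩

/-! ### The pentagons as geometric figures -/

lemma orientedArea_023 (t : ℝ) :
    orientedArea (branchPentagon (t / 2)) 0 2 3 = branchZ t / 8 := by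
  simp [orientedArea, wedge, branchZ_eq]
  ring

lemma orientedArea_234 (t : ℝ) :
    orientedArea (branchPentagon (t / 2)) 2 3 4 = branchC t * (t - branchW t) / 4 := by
  simp [orientedArea, wedge]
  ring

lemma dist_03 (t : ℝ) :
    dist (branchPentagon (t / 2) 0) (branchPentagon (t / 2) 3) = Real.sqrt ((1 + t ^ 2) / 4) := by
  rw [EuclideanSpace.dist_eq, Fin.sum_univ_two, Real.dist_eq, Real.dist_eq, sq_abs, sq_abs]
  congr 1
  simp
  ring

lemma dist_24 {t : ℝ} (ht : 0 ≤ t) :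
    dist (branchPentagon (t / 2) 2) (branchPentagon (t / 2) 4) = branchC t := by
  rw [EuclideanSpace.dist_eq, Fin.sum_univ_two, Real.dist_eq, Real.dist_eq, sq_abs, sq_abs,
    Real.sqrt_eq_iff_mul_self_eq (by positivity) (branchC_pos ht).le]
  simp
  ring

/-- For `t ≤ w` the apex `3` lies in the trapezoid spanned by the other four vertices. -/
lemma not_convex_of_le {t : ℝ} (ht : 0 < t) (h : t ≤ branchW t) :
    ¬ IsConvexPentagon (branchPentagon (t / 2)) := by
  intro hconv
  have hin : branchPentagon (t / 2) 3 ∈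
      convexHull ℝ (branchPentagon (t / 2) '' ({3}ᶜ : Set (Fin 5))) := by
    set q := branchPentagon (t / 2) with hq
    have hmem : ∀ i : Fin 5, i ≠ 3 → q i ∈ convexHull ℝ (q '' ({3}ᶜ : Set (Fin 5))) :=
      fun i hi ↦ subset_convexHull ℝ _ ⟨i, hi, rfl⟩
    have hcv := convex_convexHull ℝ (q '' ({3}ᶜ : Set (Fin 5)))
    have hs : 0 < t + branchW t := by linarith
    have hbot := hcv (hmem 0 (by decide)) (hmem 1 (by decide)) (a := 1 / 2) (b := 1 / 2)
      (by norm_num) (by norm_num) (by norm_num)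
    have htop := hcv (hmem 2 (by decide)) (hmem 4 (by decide)) (a := 1 / 2) (b := 1 / 2)
      (by norm_num) (by norm_num) (by norm_num)
    convert hcv hbot htop (a := (branchW t - t) / (t + branchW t)) (b := 2 * t / (t + branchW t))
      (div_nonneg (by linarith) hs.le) (by positivity) (by field_simp; ring) using 1
    ext l
    fin_cases l
    · simp [hq]
      ring
    · simp [hq]
      field_simp
      ring
  exact hconv _ 3 hin rfl

/-- Points are in convex position when each is strictly separated from the others by a line. -/
lemma convex_of_separating {q : Config}
    (h : ∀ i, ∃ a b : ℝ, ∀ j, j ≠ i → a * q j 0 + b * q j 1 < a * q i 0 + b * q i 1) :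
    IsConvexPentagon q := by
  intro s i hi
  by_contra his
  obtain ⟨a, b, hab⟩ := h i
  have hsub : convexHull ℝ (q '' s) ⊆
      {v : EuclideanSpace ℝ (Fin 2) | a * v 0 + b * v 1 < a * q i 0 + b * q i 1} := by
    refine convexHull_min ?_ (convex_halfSpace_lt (f := fun v : EuclideanSpace ℝ (Fin 2) ↦
      a * v 0 + b * v 1) ⟨fun u v ↦ ?_, fun r v ↦ ?_⟩ _)
    · rintro _ ⟨j, hj, rfl⟩
      exact hab j fun hji ↦ his (hji ▸ hj)
    · simp
      ring
    · simp
      ring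
  have hlt : a * q i 0 + b * q i 1 < a * q i 0 + b * q i 1 := hsub hi
  exact lt_irrefl _ hlt

lemma convex_of_lt {t : ℝ} (ht : 0 < t) (h : branchW t < t) (hc : 1 < branchC t) :
    IsConvexPentagon (branchPentagon (t / 2)) := by
  have hw := branchW_nonneg t
  have hcw := mul_nonneg (by linarith : 0 ≤ branchC t) hw
  have hct : 0 < (branchC t - 1) * t := mul_pos (by linarith) ht
  refine convex_of_separating fun i ↦ ?_
  fin_cases i
  · refine ⟨-(t + branchW t), -2 * branchC t, fun j hj ↦ ?_⟩
    fin_cases j <;> first | exact absurd rfl hj | (simp; nlinarith)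
  · refine ⟨t + branchW t, -2 * branchC t, fun j hj ↦ ?_⟩
    fin_cases j <;> first | exact absurd rfl hj | (simp; nlinarith)
  · refine ⟨t, 1, fun j hj ↦ ?_⟩
    fin_cases j <;> first | exact absurd rfl hj | (simp; nlinarith)
  · refine ⟨0, 1, fun j hj ↦ ?_⟩
    fin_cases j <;> first | exact absurd rfl hj | (simp; linarith)
  · refine ⟨-t, 1, fun j hj ↦ ?_⟩
    fin_cases j <;> first | exact absurd rfl hj | (simp; nlinarith)

lemma lt_branchW_self {t : ℝ} (ht : t ^ 2 < 3) : t < branchW t :=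
  lt_branchW (by linarith) (by nlinarith [sq_nonneg t])

lemma branchW_lt_self {t : ℝ} (ht0 : 0 ≤ t) (ht15 : t ^ 2 ≤ 15) (ht : 3 < t ^ 2) : branchW t < t :=
  branchW_lt ht15 ht0 (by nlinarith [sq_nonneg t])

lemma typeA2_of_signs {t : ℝ} (ht : 0 < t) (hc : 1 < branchC t) (h3 : t ^ 2 < 3)
    (hZ : branchZ t < 0) : IsTypeA2 (branchPentagon (t / 2)) := by
  have hw := lt_branchW_self h3
  refine ⟨not_convex_of_le ht hw.le, ?_, ?_, ?_, ?_⟩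
  · rw [orientedArea_023]
    linarith
  · rw [orientedArea_234]
    nlinarith
  · rw [dist_03, Real.sqrt_lt' one_pos]
    linarith
  · rwa [dist_24 ht.le]

lemma typeA4_of_signs {t : ℝ} (ht : 0 < t) (ht15 : t ^ 2 ≤ 15) (hc : 1 < branchC t)
    (h3 : 3 < t ^ 2) (hZ : 0 < branchZ t) : IsTypeA4 (branchPentagon (t / 2)) := by
  have hw := branchW_lt_self ht.le ht15 h3
  refine ⟨convex_of_lt ht hw hc, ?_, ?_, ?_, ?_⟩
  · rw [orientedArea_023]
    linarith
  · rw [orientedArea_234]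
    nlinarith
  · rw [dist_03, Real.lt_sqrt zero_le_one]
    linarith
  · rwa [dist_24 ht.le]

/-! ### Estimates for the powers of the distances -/

/-- The quotient `(1 - r_{2,4}^{-A}) / (1 - r_{0,2}^{-A})` in terms of `c = r_{2,4}`. -/
noncomputable def powRatio (k c : ℝ) : ℝ := (1 - gammaPow k c) / (1 - betaPow k c)

/-- By convexity of `x ↦ x ^ k`, the claim for every `k ≥ 1` follows from the one for `k = 1`. -/
lemma lt_of_powRatio_lt_half {k c : ℝ} (hk : 1 ≤ k) (hc : 1 < c) (h : powRatio k c < 1 / 2) :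
    c < 1.171 := by
  have hb : 0 < 1 - betaPow k c := by
    linarith [betaPow_lt_one (k := k) (c := c) (by linarith) (by linarith)]
  rw [powRatio, div_lt_iff₀ hb] at h
  by_contra! hc1
  have hle : (c ^ 2)⁻¹ ≤ 1 / 2 * 1 + 1 / 2 * (1 + c)⁻¹ := by
    have h1 : 0 < 1 + c := by linarith
    have h2 : 0 < c ^ 2 := by positivity
    have : 1 / 2 * 1 + 1 / 2 * (1 + c)⁻¹ - (c ^ 2)⁻¹ =
        (c ^ 3 + 2 * c ^ 2 - 2 * c - 2) / (2 * (1 + c) * c ^ 2) := by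
      field_simp
      ring
    have h3 : 0 ≤ c ^ 3 + 2 * c ^ 2 - 2 * c - 2 := by
      nlinarith [mul_nonneg (sub_nonneg.2 hc1) (sub_nonneg.2 hc1),
        mul_nonneg (mul_nonneg (sub_nonneg.2 hc1) (sub_nonneg.2 hc1)) (by linarith : 0 ≤ c)]
    have h4 := div_nonneg h3 (by positivity : 0 ≤ 2 * (1 + c) * c ^ 2)
    linarith
  have hz : 0 ≤ (1 + c)⁻¹ := by positivity
  have hjensen := (convexOn_rpow hk).2 (Set.mem_Ici.2 zero_le_one) (Set.mem_Ici.2 hz)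
    (by norm_num : (0 : ℝ) ≤ 1 / 2) (by norm_num : (0 : ℝ) ≤ 1 / 2) (by norm_num)
  simp only [smul_eq_mul] at hjensen
  have hmono := Real.rpow_le_rpow (by positivity) hle (by linarith : 0 ≤ k)
  rw [Real.one_rpow] at hjensen
  rw [gammaPow, betaPow, Real.rpow_neg (by positivity), Real.rpow_neg (by positivity),
    ← Real.inv_rpow (by positivity), ← Real.inv_rpow (by positivity)] at h
  linarith

lemma one_sub_betaPow_le {k c : ℝ} (hk : 1 ≤ k) (hc : 0 < c) :
    1 - betaPow k c ≤ k * (c / (1 + c)) := by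
  have h1 : (0 : ℝ) < 1 + c := by linarith
  have h2 : (1 + c)⁻¹ = 1 + -(c / (1 + c)) := by
    field_simp
    ring
  have h3 := one_add_mul_self_le_rpow_one_add (s := -(c / (1 + c)))
    (by rw [neg_le_neg_iff, div_le_one h1]; linarith) hk
  rw [← h2] at h3
  rw [betaPow, Real.rpow_neg h1.le, ← Real.inv_rpow h1.le]
  linarith

lemma le_alphaPow_sub_one {k t : ℝ} (hk : 1 ≤ k) (ht : t ^ 2 < 3) :
    k * ((3 - t ^ 2) / (1 + t ^ 2)) ≤ alphaPow k t - 1 := by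
  have h2 : ((1 + t ^ 2) / 4)⁻¹ = 1 + (3 - t ^ 2) / (1 + t ^ 2) := by
    field_simp
    ring
  have h3 := one_add_mul_self_le_rpow_one_add (s := (3 - t ^ 2) / (1 + t ^ 2))
    (by have : 0 ≤ (3 - t ^ 2) / (1 + t ^ 2) := div_nonneg (by linarith) (by positivity)
        linarith) hk
  rw [← h2] at h3
  rw [alphaPow, Real.rpow_neg (by positivity), ← Real.inv_rpow (by positivity)]
  linarith

/-- A lower bound for the slope of `powRatio` that does not depend on the exponent. -/
lemma powRatio_slope {k c₁ c₂ : ℝ} (hk : 1 ≤ k) (h1 : 1 < c₁) (h12 : c₁ ≤ c₂)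
    (hG₁ : powRatio k c₁ < 1 / 2) (hG₂ : powRatio k c₂ < 1 / 2) :
    (1 + c₂) / (c₁ * c₂) * (c₂ - c₁) ≤ powRatio k c₂ - powRatio k c₁ := by
  have hk0 : 0 < k := by linarith
  have hc1 : 0 < c₁ := by linarith
  have hc2 : 0 < c₂ := by linarith
  have hb1 : 0 < 1 - betaPow k c₁ := by linarith [betaPow_lt_one hk0 hc1]
  have hb2 : 0 < 1 - betaPow k c₂ := by linarith [betaPow_lt_one hk0 hc2]
  have hβ1 : 0 < betaPow k c₁ := betaPow_pos hc1
  have hβ2 : 0 < betaPow k c₂ := betaPow_pos hc2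
  have hγ2pos : 0 < gammaPow k c₂ := Real.rpow_pos_of_pos (by positivity) _
  have hb2le := one_sub_betaPow_le hk hc2
  have hγ2 : 1 / 2 + betaPow k c₂ / 2 < gammaPow k c₂ := by
    have := hG₂
    rw [powRatio, div_lt_iff₀ hb2] at this
    linarith
  -- Bernoulli's inequality for `(c₂² / c₁²) ^ k`.
  have hγ : 2 * k * gammaPow k c₂ * ((c₂ - c₁) / c₁) ≤ gammaPow k c₁ - gammaPow k c₂ := by
    have hs : 0 ≤ 2 * ((c₂ - c₁) / c₁) := by
      have := div_nonneg (sub_nonneg.2 h12) hc1.le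
      linarith
    have hB := one_add_mul_self_le_rpow_one_add (s := 2 * ((c₂ - c₁) / c₁)) (by linarith) hk
    have hle : 1 + 2 * ((c₂ - c₁) / c₁) ≤ c₂ ^ 2 / c₁ ^ 2 := by
      have : c₂ ^ 2 / c₁ ^ 2 - (1 + 2 * ((c₂ - c₁) / c₁)) = ((c₂ - c₁) / c₁) ^ 2 := by
        field_simp
        ring
      nlinarith [sq_nonneg ((c₂ - c₁) / c₁)]
    have hmono := Real.rpow_le_rpow (by linarith) hle hk0.le
    have hprod : gammaPow k c₂ * (c₂ ^ 2 / c₁ ^ 2) ^ k = gammaPow k c₁ := by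
      rw [gammaPow, gammaPow, Real.rpow_neg (by positivity), Real.rpow_neg (by positivity),
        Real.div_rpow (by positivity) (by positivity)]
      have : (c₂ ^ 2) ^ k ≠ 0 := (Real.rpow_pos_of_pos (by positivity) _).ne'
      field_simp
    have := mul_le_mul_of_nonneg_left (hB.trans hmono) hγ2pos.le
    rw [hprod] at this
    linarith
  -- Bernoulli's inequality for `((1 + c₁) / (1 + c₂)) ^ k`.
  have hβ : betaPow k c₁ - betaPow k c₂ ≤ k * betaPow k c₁ * ((c₂ - c₁) / (1 + c₂)) := by
    have hB := one_add_mul_self_le_rpow_one_add (s := -((c₂ - c₁) / (1 + c₂)))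
      (by rw [neg_le_neg_iff, div_le_one (by linarith)]; linarith) hk
    have hs : 1 + -((c₂ - c₁) / (1 + c₂)) = (1 + c₁) / (1 + c₂) := by
      field_simp
      ring
    have hprod : betaPow k c₁ * ((1 + c₁) / (1 + c₂)) ^ k = betaPow k c₂ := by
      rw [betaPow, betaPow, Real.rpow_neg (by positivity), Real.rpow_neg (by positivity),
        Real.div_rpow (by positivity) (by positivity)]
      have : (1 + c₁) ^ k ≠ 0 := (Real.rpow_pos_of_pos (by positivity) _).ne'
      field_simp
    rw [hs] at hB
    have := mul_le_mul_of_nonneg_left hB hβ1.le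
    rw [hprod] at this
    linarith
  have hβ12 : betaPow k c₁ ≤ 2 * betaPow k c₂ := by
    have hle : (1 + c₂) / (1 + c₁) ≤ c₂ ^ 2 := by
      rw [div_le_iff₀ (by linarith)]
      nlinarith
    have hmono := Real.rpow_le_rpow (by positivity) hle hk0.le
    have hprod : betaPow k c₂ * ((1 + c₂) / (1 + c₁)) ^ k = betaPow k c₁ := by
      rw [betaPow, betaPow, Real.rpow_neg (by positivity), Real.rpow_neg (by positivity),
        Real.div_rpow (by positivity) (by positivity)]
      have : (1 + c₂) ^ k ≠ 0 := (Real.rpow_pos_of_pos (by positivity) _).ne'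
      field_simp
    have h2 : (c₂ ^ 2) ^ k ≤ 2 := by
      have hinv : gammaPow k c₂ = ((c₂ ^ 2) ^ k)⁻¹ := by
        rw [gammaPow, Real.rpow_neg (by positivity)]
      have hpos : 0 < (c₂ ^ 2) ^ k := Real.rpow_pos_of_pos (by positivity) _
      have : gammaPow k c₂ * (c₂ ^ 2) ^ k = 1 := by
        rw [hinv, inv_mul_cancel₀ hpos.ne']
      nlinarith
    have := mul_le_mul_of_nonneg_left (hmono.trans h2) hβ2.le
    rw [hprod] at this
    linarith
  have hsplit : powRatio k c₂ - powRatio k c₁ = ((gammaPow k c₁ - gammaPow k c₂)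
      - powRatio k c₁ * (betaPow k c₁ - betaPow k c₂)) / (1 - betaPow k c₂) := by
    rw [powRatio, powRatio]
    field_simp
    ring
  have hβmono : 0 ≤ betaPow k c₁ - betaPow k c₂ := by
    have := Real.rpow_le_rpow_of_nonpos (by linarith : 0 < 1 + c₁)
      (by linarith : 1 + c₁ ≤ 1 + c₂) (by linarith : -k ≤ 0)
    unfold betaPow
    linarith
  -- The loss from `betaPow` is absorbed by the term `betaPow k c₂ / 2` in `hγ2`.
  have hnum : k * ((c₂ - c₁) / c₁) ≤ (gammaPow k c₁ - gammaPow k c₂)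
      - powRatio k c₁ * (betaPow k c₁ - betaPow k c₂) := by
    have hx : 0 ≤ (c₂ - c₁) / c₁ := div_nonneg (by linarith) hc1.le
    have hxy : (c₂ - c₁) / (1 + c₂) ≤ (c₂ - c₁) / c₁ :=
      div_le_div_of_nonneg_left (by linarith) hc1 (by linarith)
    have hy : 0 ≤ (c₂ - c₁) / (1 + c₂) := div_nonneg (by linarith) (by linarith)
    have hloss : powRatio k c₁ * (betaPow k c₁ - betaPow k c₂) ≤
        k * betaPow k c₂ * ((c₂ - c₁) / c₁) :=
      calc powRatio k c₁ * (betaPow k c₁ - betaPow k c₂)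
          ≤ 1 / 2 * (betaPow k c₁ - betaPow k c₂) := mul_le_mul_of_nonneg_right hG₁.le hβmono
        _ ≤ 1 / 2 * (k * betaPow k c₁ * ((c₂ - c₁) / (1 + c₂))) := by linarith
        _ ≤ 1 / 2 * (k * (2 * betaPow k c₂) * ((c₂ - c₁) / c₁)) := by gcongr
        _ = _ := by ring
    have hgain : 2 * k * (1 / 2 + betaPow k c₂ / 2) * ((c₂ - c₁) / c₁) ≤
        2 * k * gammaPow k c₂ * ((c₂ - c₁) / c₁) := by gcongr
    linarith
  rw [hsplit, le_div_iff₀ hb2]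
  refine le_trans ?_ hnum
  calc (1 + c₂) / (c₁ * c₂) * (c₂ - c₁) * (1 - betaPow k c₂)
      ≤ (1 + c₂) / (c₁ * c₂) * (c₂ - c₁) * (k * (c₂ / (1 + c₂))) := by
        refine mul_le_mul_of_nonneg_left hb2le (mul_nonneg (by positivity) (by linarith))
    _ = k * ((c₂ - c₁) / c₁) := by
        field_simp

/-! ### Uniqueness of the pentagon of type A2 -/

/-- For `t² < 3` and `Δ_{0,2,3} < 0` the equation left on `t` is `reducedFun k t = 1`, obtained by
putting `l = 2 t c / (-Z)` and dividing by positive factors. -/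
noncomputable def reducedFun (k t : ℝ) : ℝ :=
  (1 - betaPow k (branchC t)) / (alphaPow k t - 1) / (2 * (2 * t * branchC t / -branchZ t)) +
    2 * powRatio k (branchC t) * (1 + 2 * t * branchC t / -branchZ t)

lemma branchEquation_iff_reducedFun {k t : ℝ} (hk : 0 < k) (ht : 0 < t) (h3 : t ^ 2 < 3)
    (hZ : branchZ t < 0) : BranchEquation k t ↔ reducedFun k t = 1 := by
  have hc := branchC_pos ht.le
  have hb : 0 < 1 - betaPow k (branchC t) := by linarith [betaPow_lt_one hk hc]
  have ha : 0 < alphaPow k t - 1 := by linarith [alphaPow_gt_one hk h3]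
  have hw : branchW t = t - branchZ t + 2 * t * branchC t := by linarith [branchZ_eq t]
  unfold BranchEquation reducedFun powRatio
  rw [hw]
  have ha' : 1 - alphaPow k t = -(alphaPow k t - 1) := by ring
  rw [ha']
  generalize alphaPow k t - 1 = p at ha ⊢
  generalize 1 - betaPow k (branchC t) = b at hb ⊢
  obtain ⟨V, hV⟩ : ∃ V, V = -branchZ t := ⟨_, rfl⟩
  have hV0 : 0 < V := by linarith
  have hZV : branchZ t = -V := by linarith
  rw [hZV, neg_neg]
  generalize 1 - gammaPow k (branchC t) = g
  generalize branchC t = c at hc ⊢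
  have key : b / p / (2 * (2 * t * c / V)) + 2 * (g / b) * (1 + 2 * t * c / V) - 1 =
      -(b * -V * (4 * t * c * -p - b * -V) - 8 * t * c * -p * g * (t - (t - -V + 2 * t * c))) /
        (4 * t * c * p * b * V) := by
    field_simp
    ring
  have hpos : 4 * t * c * p * b * V ≠ 0 := by positivity
  constructor
  · intro h
    rw [← sub_eq_zero, key, h]
    simp
  · intro h
    rw [← sub_eq_zero, key, div_eq_zero_iff] at h
    have := h.resolve_right hpos
    linarith

/-- The bounds `1 < r_{2,4} < 1.171` confine `t` to a short interval; its exact lower end is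
`2 - √3`. -/
lemma bounds_of_lt {t : ℝ} (ht : 0 < t) (h3 : t ^ 2 < 3) (hZ : branchZ t < 0)
    (hc : 1 < branchC t) (hc' : branchC t < 1.171) : 0.2679 < t ∧ t < 0.3715 := by
  have hw := branchW_sq (by linarith : t ^ 2 ≤ 15)
  have hw0 := branchW_nonneg t
  rw [branchC] at hc hc'
  have ht1 : t < 1 := by
    by_contra! h1
    have : 0 ≤ (t ^ 2 - 1) * branchW t := mul_nonneg (by nlinarith) hw0
    rw [branchZ] at hZ
    linarith
  have e : (t * branchW t) ^ 2 * (1 + t ^ 2) = t ^ 2 * (15 - t ^ 2) := by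
    linear_combination t ^ 2 * hw
  have lo : 1 < (t * branchW t) ^ 2 := by nlinarith
  have hi : (t * branchW t) ^ 2 < 1.801 := by nlinarith [mul_nonneg ht.le hw0]
  have lo' : 1 + t ^ 2 < t ^ 2 * (15 - t ^ 2) := by rw [← e]; nlinarith [sq_nonneg t]
  have hi' : t ^ 2 * (15 - t ^ 2) < 1.801 * (1 + t ^ 2) := by rw [← e]; nlinarith [sq_nonneg t]
  constructor
  · by_contra! h
    have : t ^ 2 ≤ 0.2679 ^ 2 := by gcongr
    nlinarith [sq_nonneg t]
  · by_contra! h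
    have h1 : 0.3715 ^ 2 ≤ t ^ 2 := by gcongr
    have h2 : t ^ 2 ≤ 1 := by nlinarith
    nlinarith [mul_nonneg (sub_nonneg.2 h1) (sub_nonneg.2 h2)]

lemma branchW_mem {t : ℝ} (h1 : 0.2679 ≤ t) (h2 : t ≤ 0.3715) :
    3.61 < branchW t ∧ branchW t < 3.7323 := by
  have l : 0.2679 ^ 2 ≤ t ^ 2 := by gcongr
  have u : t ^ 2 ≤ 0.3715 ^ 2 := by gcongr
  constructor
  · exact lt_branchW (by linarith) (by linarith)
  · exact branchW_lt (by linarith) (by norm_num) (by linarith)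

lemma branchZ_mem {t : ℝ} (h1 : 0.2679 ≤ t) (h2 : t ≤ 0.3715) :
    -2.93 < branchZ t ∧ branchZ t < -2.36 := by
  have l : 0.2679 ^ 2 ≤ t ^ 2 := by gcongr
  have u : t ^ 2 ≤ 0.3715 ^ 2 := by gcongr
  obtain ⟨hl, hu⟩ := branchW_mem h1 h2
  unfold branchZ
  constructor
  · have : (1 - t ^ 2) * branchW t ≤ (1 - 0.2679 ^ 2) * 3.7323 := by
      gcongr
    linarith
  · have : (1 - 0.3715 ^ 2) * 3.61 ≤ (1 - t ^ 2) * branchW t := by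
      gcongr
      linarith
    linarith

/-- The first summand of `reducedFun` is at most about one half; by Bernoulli's inequality the
extreme exponent is `A = 2`. -/
lemma first_summand_le {k t : ℝ} (hk : 1 ≤ k) (h1 : 0.2679 ≤ t) (h2 : t ≤ 0.3715)
    (hc : 1 ≤ branchC t) :
    (1 - betaPow k (branchC t)) / (alphaPow k t - 1) / (2 * (2 * t * branchC t / -branchZ t)) ≤
      0.56 := by
  have l : 0.2679 ^ 2 ≤ t ^ 2 := by gcongr
  have u : t ^ 2 ≤ 0.3715 ^ 2 := by gcongr
  obtain ⟨hZl, hZu⟩ := branchZ_mem h1 h2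
  have ht : 0 < t := by linarith
  have hc0 : 0 < branchC t := by linarith
  have hB := one_sub_betaPow_le hk hc0
  have hA := le_alphaPow_sub_one (t := t) hk (by linarith)
  have hk0 : 0 < k := by linarith
  have h3 : 0 < 3 - t ^ 2 := by linarith
  have hA0 : 0 < k * ((3 - t ^ 2) / (1 + t ^ 2)) := by positivity
  have hR : (1 - betaPow k (branchC t)) / (alphaPow k t - 1) ≤
      k * (branchC t / (1 + branchC t)) / (k * ((3 - t ^ 2) / (1 + t ^ 2))) := by
    gcongr
  have hR' : k * (branchC t / (1 + branchC t)) / (k * ((3 - t ^ 2) / (1 + t ^ 2))) ≤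
      branchC t * 0.2 := by
    have : k * (branchC t / (1 + branchC t)) / (k * ((3 - t ^ 2) / (1 + t ^ 2))) =
        branchC t * ((1 + t ^ 2) / ((1 + branchC t) * (3 - t ^ 2))) := by
      field_simp
    rw [this]
    gcongr
    rw [div_le_iff₀ (by positivity)]
    nlinarith [mul_le_mul hc (by linarith : 2.86 ≤ 3 - t ^ 2) (by norm_num) hc0.le]
  have hV : 0 < -branchZ t := by linarith
  have hl : 0 < 2 * (2 * t * branchC t / -branchZ t) := by positivity
  rw [div_le_iff₀ hl]
  refine (hR.trans hR').trans ?_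
  have : (0.56 : ℝ) * (2 * (2 * t * branchC t / -branchZ t)) =
      branchC t * (2.24 * t / -branchZ t) := by
    field_simp
    ring
  rw [this]
  gcongr
  rw [le_div_iff₀ hV]
  linarith

lemma branchW_sub_le {t₁ t₂ : ℝ} (h1 : 0.2679 ≤ t₁) (h12 : t₁ ≤ t₂) (h2 : t₂ ≤ 0.3715) :
    0 ≤ branchW t₁ - branchW t₂ ∧ branchW t₁ - branchW t₂ ≤ 1.45 * (t₂ - t₁) := by
  obtain ⟨l1, -⟩ := branchW_mem h1 (h12.trans h2)
  obtain ⟨l2, -⟩ := branchW_mem (h1.trans h12) h2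
  have hs1 : 0.2679 ^ 2 ≤ t₁ ^ 2 := by gcongr
  have hs2 : 0.2679 ^ 2 ≤ t₂ ^ 2 := by have := h1.trans h12; gcongr
  have hu2 : t₂ ^ 2 ≤ 0.3715 ^ 2 := pow_le_pow_left₀ (by linarith) h2 2
  have hu1 : t₁ ^ 2 ≤ t₂ ^ 2 := by gcongr
  have e1 := branchW_sq (t := t₁) (by linarith)
  have e2 := branchW_sq (t := t₂) (by linarith)
  set w₁ := branchW t₁
  set w₂ := branchW t₂
  have hden : 8.29 ≤ (1 + t₁ ^ 2) * (1 + t₂ ^ 2) * (w₁ + w₂) := by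
    have : (1 + 0.2679 ^ 2) * (1 + 0.2679 ^ 2) * (3.61 + 3.61) ≤
        (1 + t₁ ^ 2) * (1 + t₂ ^ 2) * (w₁ + w₂) := by gcongr
    linarith
  have e : (w₁ - w₂) * ((1 + t₁ ^ 2) * (1 + t₂ ^ 2) * (w₁ + w₂)) =
      16 * (t₂ + t₁) * (t₂ - t₁) := by
    linear_combination (1 + t₂ ^ 2) * e1 - (1 + t₁ ^ 2) * e2
  have hd : 0 ≤ t₂ - t₁ := by linarith
  have hnn : 0 ≤ w₁ - w₂ := by
    refine nonneg_of_mul_nonneg_left (b := (1 + t₁ ^ 2) * (1 + t₂ ^ 2) * (w₁ + w₂)) ?_ (by linarith)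
    rw [e]
    have : 0 ≤ t₂ + t₁ := by linarith
    positivity
  refine ⟨hnn, ?_⟩
  have a1 := mul_le_mul_of_nonneg_left hden hnn
  have a2 : 16 * (t₂ + t₁) * (t₂ - t₁) ≤ 16 * 0.743 * (t₂ - t₁) := by
    gcongr
    linarith
  rw [e] at a1
  linarith

lemma one_sub_prod_le {x y z : ℝ} (hx : 0 ≤ x) (hy : 0 ≤ y) (hz : 0 ≤ z) (hy1 : y ≤ 1)
    : 1 - (1 - x) * (1 - y) * (1 - z) ≤ x + y + z := by
  have h1 : (1 - x) * (1 - y) ≤ 1 := mul_le_one₀ (by linarith) (by linarith) (by linarith)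
  have h2 := mul_le_mul_of_nonneg_right h1 hz
  linarith [mul_nonneg hx hy]

/-- The relative growth of `2 t c / V` is at most the sum of those of `t`, `c` and `1 / V`. -/
lemma one_sub_quotient_le {t₁ t₂ c₁ c₂ V₁ V₂ : ℝ} (h1 : 0.2679 ≤ t₁) (h12 : t₁ ≤ t₂)
    (hc1 : 1 ≤ c₁) (hc12 : c₁ ≤ c₂) (hV₁ : 2.36 ≤ V₁) (hV : V₁ - V₂ ≤ 6.15 * (t₂ - t₁))
    (hV12 : V₂ ≤ V₁) :
    1 - 2 * t₁ * c₁ / V₁ / (2 * t₂ * c₂ / V₂) ≤ (c₂ - c₁) + (3.74 + 2.61) * (t₂ - t₁) := by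
  have hV1 : 0 < V₁ := by linarith
  have ht1 : 0 < t₁ := by linarith
  have ht2 : 0 < t₂ := by linarith
  have hc2 : 0 < c₂ := by linarith
  have hd : 0 ≤ t₂ - t₁ := by linarith
  have e : 1 - 2 * t₁ * c₁ / V₁ / (2 * t₂ * c₂ / V₂) =
      1 - (1 - (V₁ - V₂) / V₁) * (1 - (c₂ - c₁) / c₂) * (1 - (t₂ - t₁) / t₂) := by
    field_simp
    ring
  have a1 : (V₁ - V₂) / V₁ ≤ 2.61 * (t₂ - t₁) := by
    rw [div_le_iff₀ hV1]
    have : 2.61 * (t₂ - t₁) * 2.36 ≤ 2.61 * (t₂ - t₁) * V₁ := by gcongr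
    linarith
  have a2 : (c₂ - c₁) / c₂ ≤ c₂ - c₁ := div_le_self (by linarith) (by linarith)
  have a3 : (t₂ - t₁) / t₂ ≤ 3.74 * (t₂ - t₁) := by
    rw [div_le_iff₀ ht2]
    have : 3.74 * (t₂ - t₁) * 0.2679 ≤ 3.74 * (t₂ - t₁) * t₂ := by
      gcongr
      linarith
    linarith
  have h := one_sub_prod_le (div_nonneg (by linarith) hV1.le : 0 ≤ (V₁ - V₂) / V₁)
    (div_nonneg (by linarith) hc2.le : 0 ≤ (c₂ - c₁) / c₂) (div_nonneg hd ht2.le)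
    ((div_le_one hc2).2 (by linarith))
  rw [e]
  linarith

/-- Two different pentagons of type A2 are never solutions for the same exponent. Subtracting
the equations `reducedFun k t₁ = 1 = reducedFun k t₂`, the growth of `powRatio` outweighs the
decay of the first summand, of which only the factor `-Z / (2 t c)` is decreasing. -/
lemma not_lt_of_reducedFun {k t₁ t₂ : ℝ} (hk : 1 ≤ k) (h1 : 0.2679 ≤ t₁) (h12 : t₁ < t₂)
    (h2 : t₂ ≤ 0.3715) (hc1 : 1 < branchC t₁) (hc2 : branchC t₂ < 1.171)
    (hG₁ : powRatio k (branchC t₁) < 1 / 2) (hG₂ : powRatio k (branchC t₂) < 1 / 2)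
    (e1 : reducedFun k t₁ = 1) (e2 : reducedFun k t₂ = 1) : False := by
  have hk0 : 0 < k := by linarith
  obtain ⟨hw12, hw12'⟩ := branchW_sub_le h1 h12.le h2
  obtain ⟨lw1, uw1⟩ := branchW_mem h1 (h12.le.trans h2)
  obtain ⟨lw2, uw2⟩ := branchW_mem (h1.trans h12.le) h2
  obtain ⟨lZ1, uZ1⟩ := branchZ_mem h1 (h12.le.trans h2)
  obtain ⟨lZ2, uZ2⟩ := branchZ_mem (h1.trans h12.le) h2
  have hs1 : 0.2679 ^ 2 ≤ t₁ ^ 2 := by gcongr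
  have hu2 : t₂ ^ 2 ≤ 0.3715 ^ 2 := pow_le_pow_left₀ (by linarith) h2 2
  have hu1 : t₁ ^ 2 ≤ t₂ ^ 2 := by gcongr
  have ht1 : 0 < t₁ := by linarith
  have ht2 : 0 < t₂ := by linarith
  have hd : 0 < t₂ - t₁ := by linarith
  have hΔc : 1.5 * (t₂ - t₁) ≤ branchC t₂ - branchC t₁ := by
    have e : branchC t₂ - branchC t₁ =
        (branchW t₂ * (t₂ - t₁) - t₁ * (branchW t₁ - branchW t₂)) / 2 := by
      unfold branchC
      ring
    have a1 : 3.61 * (t₂ - t₁) ≤ branchW t₂ * (t₂ - t₁) := by gcongr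
    have a2 : t₁ * (branchW t₁ - branchW t₂) ≤ 0.3715 * (1.45 * (t₂ - t₁)) := by
      gcongr
      linarith
    rw [e]
    linarith
  have hΔZ : branchZ t₂ - branchZ t₁ ≤ 6.15 * (t₂ - t₁) ∧ branchZ t₁ ≤ branchZ t₂ := by
    have e : branchZ t₂ - branchZ t₁ = 2 * (t₂ - t₁) + (branchW t₁ - branchW t₂) * (1 - t₁ ^ 2)
        + branchW t₂ * ((t₂ + t₁) * (t₂ - t₁)) := by
      unfold branchZ
      ring
    have p1 : 0 ≤ (branchW t₁ - branchW t₂) * (1 - t₁ ^ 2) := mul_nonneg hw12 (by linarith)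
    have p2 : 0 ≤ branchW t₂ * ((t₂ + t₁) * (t₂ - t₁)) := by
      have : 0 < t₂ + t₁ := by linarith
      positivity
    have a1 : (branchW t₁ - branchW t₂) * (1 - t₁ ^ 2) ≤
        1.45 * (t₂ - t₁) * (1 - 0.2679 ^ 2) := by
      gcongr
      linarith
    have a2 : branchW t₂ * ((t₂ + t₁) * (t₂ - t₁)) ≤ 3.7323 * (0.743 * (t₂ - t₁)) := by
      gcongr
      linarith
    constructor <;> linarith
  obtain ⟨hΔZ, hZmono⟩ := hΔZ
  have hc12 : branchC t₁ ≤ branchC t₂ := by linarith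
  have hslope := powRatio_slope hk hc1 hc12 hG₁ hG₂
  have hρ := first_summand_le hk h1 (h12.le.trans h2) hc1.le
  have hβ : betaPow k (branchC t₂) ≤ betaPow k (branchC t₁) :=
    Real.rpow_le_rpow_of_nonpos (by linarith) (by linarith) (by linarith)
  have hα : alphaPow k t₂ ≤ alphaPow k t₁ :=
    Real.rpow_le_rpow_of_nonpos (by positivity) (by linarith) (by linarith)
  have hα2 : 0 < alphaPow k t₂ - 1 := by linarith [alphaPow_gt_one hk0 (by linarith : t₂ ^ 2 < 3)]
  have hβ1 : 0 < 1 - betaPow k (branchC t₁) := by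
    linarith [betaPow_lt_one hk0 (by linarith : 0 < branchC t₁)]
  have hG1 : 0 ≤ powRatio k (branchC t₁) :=
    div_nonneg (by linarith [gammaPow_lt_one hk0 hc1]) hβ1.le
  unfold reducedFun at e1 e2
  have hRmono : (1 - betaPow k (branchC t₁)) / (alphaPow k t₁ - 1) ≤
      (1 - betaPow k (branchC t₂)) / (alphaPow k t₂ - 1) := by
    gcongr
    linarith
  have hR1 : 0 < (1 - betaPow k (branchC t₁)) / (alphaPow k t₁ - 1) :=
    div_pos hβ1 (by linarith)
  generalize (1 - betaPow k (branchC t₁)) / (alphaPow k t₁ - 1) = R₁ at *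
  generalize (1 - betaPow k (branchC t₂)) / (alphaPow k t₂ - 1) = R₂ at *
  generalize powRatio k (branchC t₁) = G₁ at *
  generalize powRatio k (branchC t₂) = G₂ at *
  generalize branchC t₁ = c₁ at *
  generalize branchC t₂ = c₂ at *
  obtain ⟨V₁, hV₁⟩ : ∃ V, V = -branchZ t₁ := ⟨_, rfl⟩
  obtain ⟨V₂, hV₂⟩ : ∃ V, V = -branchZ t₂ := ⟨_, rfl⟩
  rw [← hV₁] at e1 hρ
  rw [← hV₂] at e2
  have hV1 : 0 < V₁ := by linarith
  have hV2 : 0 < V₂ := by linarith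
  have hc1' : 0 < c₁ := by linarith
  have hc2' : 0 < c₂ := by linarith
  obtain ⟨l₁, hl₁⟩ : ∃ l, l = 2 * t₁ * c₁ / V₁ := ⟨_, rfl⟩
  obtain ⟨l₂, hl₂⟩ : ∃ l, l = 2 * t₂ * c₂ / V₂ := ⟨_, rfl⟩
  rw [← hl₁] at e1 hρ
  rw [← hl₂] at e2
  have hl1 : 0 < l₁ := by rw [hl₁]; positivity
  have hl12 : l₁ ≤ l₂ := by
    rw [hl₁, hl₂]
    gcongr
    linarith
  have hl2 : 0.18 ≤ l₂ := by
    rw [hl₂, le_div_iff₀ hV2]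
    have : 2 * 0.2679 * 1 ≤ 2 * t₂ * c₂ := by
      gcongr <;> linarith
    linarith
  have hq : 1 - l₁ / l₂ ≤ (c₂ - c₁) + (3.74 + 2.61) * (t₂ - t₁) := by
    rw [hl₁, hl₂]
    exact one_sub_quotient_le h1 h12.le hc1.le hc12 (by linarith) (by linarith) (by linarith)
  have hS : 1.58 * (c₂ - c₁) ≤ G₂ - G₁ := by
    refine le_trans (mul_le_mul_of_nonneg_right ?_ (by linarith)) hslope
    rw [le_div_iff₀ (by positivity)]
    have := mul_le_mul_of_nonneg_right (by linarith : c₁ ≤ 1.171) hc2'.le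
    linarith
  -- Comparing the two equations, `2 (G₂ - G₁) (1 + l₂)` is at most `0.56 (1 - l₁ / l₂)`, while
  -- the bounds above give at least `3.7 (c₂ - c₁)` for the former and at most `3 (c₂ - c₁)` for the
  -- latter.
  have hfirst : R₁ / (2 * l₁) * (l₁ / l₂) ≤ R₂ / (2 * l₂) := by
    have : R₁ / (2 * l₁) * (l₁ / l₂) = R₁ / (2 * l₂) := by field_simp
    rw [this]
    gcongr
  have hq0 : 0 ≤ 1 - l₁ / l₂ := by
    rw [sub_nonneg, div_le_one (by linarith)]
    exact hl12
  have hdrop := mul_le_mul_of_nonneg_right hρ hq0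
  have hG12 : 0 ≤ G₁ * (l₂ - l₁) := mul_nonneg hG1 (by linarith)
  have hgain : 1.58 * (c₂ - c₁) * 1.18 ≤ (G₂ - G₁) * (1 + l₂) :=
    mul_le_mul hS (by linarith) (by norm_num) (le_trans (mul_nonneg (by norm_num) (by linarith)) hS)
  linarith

/-! ### Existence -/

lemma continuous_branchW : Continuous branchW := by
  unfold branchW
  exact Real.continuous_sqrt.comp
    (Continuous.div (by fun_prop) (by fun_prop) fun t ↦ by positivity)

lemma continuous_branchC : Continuous branchC := by
  have := continuous_branchW
  unfold branchC
  fun_prop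

lemma continuous_branchZ : Continuous branchZ := by
  have := continuous_branchW
  unfold branchZ
  fun_prop

lemma continuous_alphaPow (k : ℝ) : Continuous (alphaPow k) := by
  unfold alphaPow
  exact Continuous.rpow_const (by fun_prop) fun t ↦ Or.inl (by positivity)

lemma continuousOn_betaPow (k : ℝ) : ContinuousOn (fun t ↦ betaPow k (branchC t)) (Set.Ici 0) := by
  have := continuous_branchC
  unfold betaPow
  exact ContinuousOn.rpow_const (by fun_prop) fun t ht ↦
    Or.inl (by linarith [branchC_pos (Set.mem_Ici.1 ht)])

lemma continuousOn_gammaPow (k : ℝ) :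
    ContinuousOn (fun t ↦ gammaPow k (branchC t)) (Set.Ici 0) := by
  have := continuous_branchC
  unfold gammaPow
  exact ContinuousOn.rpow_const (by fun_prop) fun t ht ↦
    Or.inl (pow_ne_zero 2 (branchC_pos (Set.mem_Ici.1 ht)).ne')

lemma sqrt_three_bounds : 1.7320 < Real.sqrt 3 ∧ Real.sqrt 3 < 1.73206 :=
  ⟨(Real.lt_sqrt (by norm_num)).2 (by norm_num), (Real.sqrt_lt' (by norm_num)).2 (by norm_num)⟩

/-- `r_{2,4} > 1` holds exactly between the two values `2 ∓ √3` of `t`. -/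
lemma one_lt_branchC {t : ℝ} (h1 : 2 - Real.sqrt 3 < t) (h2 : t < 2 + Real.sqrt 3) :
    1 < branchC t := by
  obtain ⟨l3, u3⟩ := sqrt_three_bounds
  have h3 : Real.sqrt 3 ^ 2 = 3 := Real.sq_sqrt (by norm_num)
  have ht : 0 < t := by linarith
  have ht15 : t ^ 2 ≤ 15 := by nlinarith
  have hlow : t * (2 - Real.sqrt 3) < 1 := by nlinarith
  have hhigh : 1 < t * (2 + Real.sqrt 3) := by nlinarith
  have hw : 1 / t < branchW t := by
    refine lt_branchW ht15 ?_
    have : 0 < 15 - t ^ 2 - (1 / t) ^ 2 * (1 + t ^ 2) := by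
      have e : 15 - t ^ 2 - (1 / t) ^ 2 * (1 + t ^ 2) =
          -((t ^ 2 - (2 - Real.sqrt 3) ^ 2) * (t ^ 2 - (2 + Real.sqrt 3) ^ 2)) / t ^ 2 := by
        field_simp
        ring_nf
        have h4 : Real.sqrt 3 ^ 4 = 9 := by
          rw [show Real.sqrt 3 ^ 4 = (Real.sqrt 3 ^ 2) ^ 2 by ring, h3]
          norm_num
        rw [h4, h3]
        ring
      rw [e]
      have a1 : 0 < t ^ 2 - (2 - Real.sqrt 3) ^ 2 := by nlinarith
      have a2 : 0 < (2 + Real.sqrt 3) ^ 2 - t ^ 2 := by nlinarith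
      refine div_pos ?_ (by positivity)
      nlinarith [mul_pos a1 a2]
    linarith
  rw [div_lt_iff₀ ht] at hw
  unfold branchC
  linarith

lemma branchW_two_add : branchW (2 + Real.sqrt 3) = 2 - Real.sqrt 3 := by
  have h3 : Real.sqrt 3 ^ 2 = 3 := Real.sq_sqrt (by norm_num)
  refine branchW_eq (by linarith [sqrt_three_bounds.2]) ?_
  linear_combination (Real.sqrt 3 ^ 2 - 3) * h3

lemma branchW_two_sub : branchW (2 - Real.sqrt 3) = 2 + Real.sqrt 3 := by
  have h3 : Real.sqrt 3 ^ 2 = 3 := Real.sq_sqrt (by norm_num)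
  refine branchW_eq (by positivity) ?_
  linear_combination (Real.sqrt 3 ^ 2 - 3) * h3

lemma branchC_two_add : branchC (2 + Real.sqrt 3) = 1 := by
  have h3 : Real.sqrt 3 ^ 2 = 3 := Real.sq_sqrt (by norm_num)
  rw [branchC, branchW_two_add]
  linear_combination (-1 / 2) * h3

lemma branchC_two_sub : branchC (2 - Real.sqrt 3) = 1 := by
  have h3 : Real.sqrt 3 ^ 2 = 3 := Real.sq_sqrt (by norm_num)
  rw [branchC, branchW_two_sub]
  linear_combination (-1 / 2) * h3

lemma gammaPow_one (k : ℝ) : gammaPow k 1 = 1 := by simp [gammaPow]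

/-- A pentagon of type A4 solves the equation: the difference of the two sides changes sign between
`t = √3`, where `r_{0,3} = 1`, and `t = 2 + √3`, where `r_{2,4} = 1`. -/
lemma exists_branchEquation_A4 {k : ℝ} (hk : 1 ≤ k) :
    ∃ t, 0 < t ∧ t ^ 2 ≤ 15 ∧ 3 < t ^ 2 ∧ 1 < branchC t ∧ 0 < branchZ t ∧ BranchEquation k t := by
  obtain ⟨l3, u3⟩ := sqrt_three_bounds
  have h3 : Real.sqrt 3 ^ 2 = 3 := Real.sq_sqrt (by norm_num)
  have hk0 : 0 < k := by linarith
  let F : ℝ → ℝ := fun t ↦ (1 - betaPow k (branchC t)) * branchZ t *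
      (4 * t * branchC t * (1 - alphaPow k t) - (1 - betaPow k (branchC t)) * branchZ t) -
    8 * t * branchC t * (1 - alphaPow k t) * (1 - gammaPow k (branchC t)) * (t - branchW t)
  have hF : ContinuousOn F (Set.Icc (Real.sqrt 3) (2 + Real.sqrt 3)) := by
    have c1 := continuous_branchW
    have c2 := continuous_branchC
    have c3 := continuous_branchZ
    have c4 := continuous_alphaPow k
    have c5 := continuousOn_betaPow k
    have c6 := continuousOn_gammaPow k
    refine ContinuousOn.mono (s := Set.Ici 0) ?_ fun t ht ↦ le_trans (by positivity) ht.1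
    fun_prop
  have hb : ∀ {t}, 0 ≤ t → 0 < 1 - betaPow k (branchC t) := fun ht ↦ by
    linarith [betaPow_lt_one hk0 (branchC_pos ht)]
  have hF1 : F (Real.sqrt 3) < 0 := by
    have hal : alphaPow k (Real.sqrt 3) = 1 := by
      rw [alphaPow, h3]
      norm_num
    have hZ : 0 < branchZ (Real.sqrt 3) := by
      rw [branchZ, h3]
      linarith [branchW_nonneg (Real.sqrt 3)]
    have := mul_pos (hb (Real.sqrt_nonneg 3)) hZ
    simp only [F, hal]
    nlinarith
  have hF2 : 0 < F (2 + Real.sqrt 3) := by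
    have hbeta := hb (by positivity : 0 ≤ 2 + Real.sqrt 3)
    have hβ0 : 0 < betaPow k (branchC (2 + Real.sqrt 3)) :=
      betaPow_pos (branchC_pos (by positivity))
    have hZ : branchZ (2 + Real.sqrt 3) = 4 + 4 * Real.sqrt 3 := by
      rw [branchZ_eq, branchW_two_add, branchC_two_add]
      ring
    simp only [F, hZ, branchC_two_add, gammaPow_one] at hbeta hβ0 ⊢
    -- `((1 + t²) / 4)⁻¹ = 2 - √3` at this endpoint.
    have hal : alphaPow k (2 + Real.sqrt 3) ≤ 2 - Real.sqrt 3 := by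
      have e : (1 + (2 + Real.sqrt 3) ^ 2) / 4 = 2 + Real.sqrt 3 := by
        linear_combination (1 / 4) * h3
      rw [alphaPow, e]
      calc (2 + Real.sqrt 3) ^ (-k) ≤ (2 + Real.sqrt 3) ^ (-1 : ℝ) :=
            Real.rpow_le_rpow_of_exponent_le (by linarith) (by linarith)
        _ = 2 - Real.sqrt 3 := by
            rw [Real.rpow_neg_one, inv_eq_iff_eq_inv, eq_comm, inv_eq_of_mul_eq_one_right]
            linear_combination -h3
    have h4 : 4 + 4 * Real.sqrt 3 ≤ 4 * (2 + Real.sqrt 3) * 1 *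
        (1 - alphaPow k (2 + Real.sqrt 3)) := by
      have : 4 * (2 + Real.sqrt 3) * (Real.sqrt 3 - 1) ≤ 4 * (2 + Real.sqrt 3) *
          (1 - alphaPow k (2 + Real.sqrt 3)) :=
        mul_le_mul_of_nonneg_left (by linarith) (by positivity)
      linarith
    have h5 := mul_pos hβ0 (by linarith : 0 < 4 + 4 * Real.sqrt 3)
    have h6 : 0 < (1 - betaPow k 1) * (4 + 4 * Real.sqrt 3) := mul_pos hbeta (by linarith)
    have h7 := mul_pos h6 (by linarith : 0 < 4 * (2 + Real.sqrt 3) * 1 *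
        (1 - alphaPow k (2 + Real.sqrt 3)) - (1 - betaPow k 1) * (4 + 4 * Real.sqrt 3))
    linarith
  obtain ⟨t, ⟨ht1, ht2⟩, ht⟩ := intermediate_value_Icc (by linarith) hF ⟨hF1.le, hF2.le⟩
  have hlt1 : Real.sqrt 3 < t := lt_of_le_of_ne ht1 fun h ↦ by rw [← h] at ht; linarith
  have hlt2 : t < 2 + Real.sqrt 3 := lt_of_le_of_ne ht2 fun h ↦ by rw [h] at ht; linarith
  have ht0 : 0 < t := by linarith
  have hsq : 3 < t ^ 2 := by nlinarith
  refine ⟨t, ht0, by nlinarith, hsq, one_lt_branchC (by linarith) hlt2, ?_, ?_⟩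
  · have := mul_nonneg (by linarith : 0 ≤ t ^ 2 - 1) (branchW_nonneg t)
    rw [branchZ]
    linarith
  · exact sub_eq_zero.1 ht

/-- A pentagon of type A2 solves the equation: `reducedFun` passes through `1` between
`t = 2 - √3`, where `r_{2,4} = 1`, and a value of `t` where `powRatio` is already at least `1 / 2`.
-/
lemma exists_branchEquation_A2 {k : ℝ} (hk : 1 ≤ k) :
    ∃ t, 0 < t ∧ t ^ 2 < 3 ∧ 1 < branchC t ∧ branchZ t < 0 ∧ BranchEquation k t := by
  obtain ⟨l3, u3⟩ := sqrt_three_bounds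
  have hk0 : 0 < k := by linarith
  have hmem : ∀ {t : ℝ}, t ∈ Set.Icc (2 - Real.sqrt 3) 0.3715 → 0.2679 ≤ t ∧ t ≤ 0.3715 :=
    fun ht ↦ ⟨by linarith [ht.1], ht.2⟩
  have hsq : ∀ {t : ℝ}, t ∈ Set.Icc (2 - Real.sqrt 3) 0.3715 → t ^ 2 < 3 := fun ht ↦ by
    obtain ⟨h1, h2⟩ := hmem ht
    nlinarith
  have hb : ∀ {t : ℝ}, 0 ≤ t → 0 < 1 - betaPow k (branchC t) := fun ht ↦ by
    linarith [betaPow_lt_one hk0 (branchC_pos ht)]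
  have hcont : ContinuousOn (reducedFun k) (Set.Icc (2 - Real.sqrt 3) 0.3715) := by
    have hIci : Set.Icc (2 - Real.sqrt 3) 0.3715 ⊆ Set.Ici 0 := fun t ht ↦ by
      have := hmem ht
      exact Set.mem_Ici.2 (by linarith)
    have c2 := continuous_branchC
    have c3 := continuous_branchZ
    have c4 := continuous_alphaPow k
    have c5 := (continuousOn_betaPow k).mono hIci
    have c6 := (continuousOn_gammaPow k).mono hIci
    have hZ : ∀ t ∈ Set.Icc (2 - Real.sqrt 3) 0.3715, -branchZ t ≠ 0 := fun t ht ↦ by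
      have := branchZ_mem (hmem ht).1 (hmem ht).2
      linarith
    have cl : ContinuousOn (fun t ↦ 2 * t * branchC t / -branchZ t)
        (Set.Icc (2 - Real.sqrt 3) 0.3715) := ContinuousOn.div (by fun_prop) (by fun_prop) hZ
    have cG : ContinuousOn (fun t ↦ powRatio k (branchC t)) (Set.Icc (2 - Real.sqrt 3) 0.3715) :=
      ContinuousOn.div (by fun_prop) (by fun_prop) fun t ht ↦ (hb (hIci ht)).ne'
    have cR : ContinuousOn (fun t ↦ (1 - betaPow k (branchC t)) / (alphaPow k t - 1))
        (Set.Icc (2 - Real.sqrt 3) 0.3715) :=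
      ContinuousOn.div (by fun_prop) (by fun_prop) fun t ht ↦ by
        linarith [alphaPow_gt_one hk0 (hsq ht)]
    unfold reducedFun
    refine ContinuousOn.add (ContinuousOn.div cR (by fun_prop) fun t ht ↦ ?_) (by fun_prop)
    have h1 : 0 < t := by linarith [hmem ht]
    have h2 : 0 < -branchZ t := by linarith [branchZ_mem (hmem ht).1 (hmem ht).2]
    have h3 := branchC_pos h1.le
    positivity
  have hle : 2 - Real.sqrt 3 ≤ (0.3715 : ℝ) := by linarith
  have hleft : reducedFun k (2 - Real.sqrt 3) < 1 := by
    have h1 := first_summand_le (t := 2 - Real.sqrt 3) hk (by linarith) (by linarith)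
      branchC_two_sub.ge
    have h2 : powRatio k (branchC (2 - Real.sqrt 3)) = 0 := by
      rw [branchC_two_sub, powRatio, gammaPow_one]
      simp
    rw [reducedFun, h2]
    linarith
  have hright : 1 < reducedFun k 0.3715 := by
    have hZ := branchZ_mem (t := 0.3715) (by norm_num) (by norm_num)
    have hw : 3.613 < branchW 0.3715 := lt_branchW (by norm_num) (by norm_num)
    have hc : 1.171 ≤ branchC 0.3715 := by
      unfold branchC
      linarith
    have hG : 1 / 2 ≤ powRatio k (branchC 0.3715) := by
      by_contra! hlt
      exact absurd (lt_of_powRatio_lt_half hk (by linarith) hlt) (by linarith)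
    have hV : 0 < -branchZ 0.3715 := by linarith
    have hc0 : 0 < branchC 0.3715 := by linarith
    have hα : 0 < alphaPow k 0.3715 - 1 := by
      linarith [alphaPow_gt_one hk0 (by norm_num : (0.3715 : ℝ) ^ 2 < 3)]
    have hβ := hb (by norm_num : (0 : ℝ) ≤ 0.3715)
    have hl : 0 < 2 * 0.3715 * branchC 0.3715 / -branchZ 0.3715 := by positivity
    have hR : 0 < (1 - betaPow k (branchC 0.3715)) / (alphaPow k 0.3715 - 1) /
        (2 * (2 * 0.3715 * branchC 0.3715 / -branchZ 0.3715)) := by positivity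
    rw [reducedFun]
    have := mul_le_mul_of_nonneg_right hG hl.le
    linarith
  obtain ⟨t, ht, hteq⟩ := intermediate_value_Icc hle hcont ⟨hleft.le, hright.le⟩
  have hne : 2 - Real.sqrt 3 < t := lt_of_le_of_ne ht.1 fun h ↦ by rw [← h] at hteq; linarith
  obtain ⟨ht1, ht2⟩ := hmem ht
  have ht0 : 0 < t := by linarith
  have hZ : branchZ t < 0 := by linarith [branchZ_mem ht1 ht2]
  exact ⟨t, ht0, hsq ht, one_lt_branchC hne (by linarith), hZ,
    (branchEquation_iff_reducedFun hk0 ht0 (hsq ht) hZ).2 hteq⟩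

/-! ### The classification -/

lemma branchEquation_A2_unique {k t₁ t₂ : ℝ} (hk : 1 ≤ k)
    (ht1 : 0 < t₁) (ht2 : 0 < t₂) (h31 : t₁ ^ 2 < 3) (h32 : t₂ ^ 2 < 3)
    (hc1 : 1 < branchC t₁) (hc2 : 1 < branchC t₂) (hZ1 : branchZ t₁ < 0) (hZ2 : branchZ t₂ < 0)
    (e1 : BranchEquation k t₁) (e2 : BranchEquation k t₂) : t₁ = t₂ := by
  have hk0 : 0 < k := by linarith
  have hG : ∀ {t : ℝ}, 0 < t → t ^ 2 < 3 → 1 < branchC t → branchZ t < 0 → reducedFun k t = 1 →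
      powRatio k (branchC t) < 1 / 2 := by
    intro t ht h3 hc hZ e
    have hβ : 0 < 1 - betaPow k (branchC t) := by
      linarith [betaPow_lt_one hk0 (branchC_pos ht.le)]
    have hα : 0 < alphaPow k t - 1 := by linarith [alphaPow_gt_one hk0 h3]
    have hV : 0 < -branchZ t := by linarith
    have hc0 := branchC_pos ht.le
    have hR : 0 < (1 - betaPow k (branchC t)) / (alphaPow k t - 1) /
        (2 * (2 * t * branchC t / -branchZ t)) := by positivity
    have hl : 0 < 2 * t * branchC t / -branchZ t := by positivity
    have hγ := gammaPow_lt_one hk0 hc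
    have hG0 : 0 < powRatio k (branchC t) := div_pos (by linarith) hβ
    rw [reducedFun] at e
    have := mul_pos hG0 hl
    linarith
  rw [branchEquation_iff_reducedFun hk0 ht1 h31 hZ1] at e1
  rw [branchEquation_iff_reducedFun hk0 ht2 h32 hZ2] at e2
  have hG1 := hG ht1 h31 hc1 hZ1 e1
  have hG2 := hG ht2 h32 hc2 hZ2 e2
  have hc1' := lt_of_powRatio_lt_half hk hc1 hG1
  have hc2' := lt_of_powRatio_lt_half hk hc2 hG2
  obtain ⟨a1, b1⟩ := bounds_of_lt ht1 h31 hZ1 hc1 hc1'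
  obtain ⟨a2, b2⟩ := bounds_of_lt ht2 h32 hZ2 hc2 hc2'
  rcases lt_trichotomy t₁ t₂ with h | h | h
  · exact (not_lt_of_reducedFun hk a1.le h b2.le hc1 hc2' hG1 hG2 e1 e2).elim
  · exact h
  · exact (not_lt_of_reducedFun hk a2.le h b1.le hc2 hc1' hG2 hG1 e2 e1).elim

lemma isBranchA_iff (q : Config) :
    IsBranchA q ↔ ∃ t : ℝ, 0 ≤ t ∧ t ^ 2 ≤ 15 ∧ q = branchPentagon (t / 2) := by
  constructor
  · rintro ⟨y, hy0, hy, rfl⟩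
    exact ⟨2 * y, by positivity, sq_le_of_radicand_nonneg hy,
      by rw [mul_div_cancel_left₀ y two_ne_zero]⟩
  · rintro ⟨t, ht0, ht, rfl⟩
    refine ⟨t / 2, by positivity, ?_, rfl⟩
    have : -16 * (t / 2) ^ 4 + 56 * (t / 2) ^ 2 + 15 = (15 - t ^ 2) * (1 + t ^ 2) := by ring
    rw [this]
    exact mul_nonneg (by linarith) (by positivity)

theorem theorem2 :
    (∀ A : ℝ, 2 ≤ A → ∀ (m : Fin 5 → ℝ) (q : Config),
      IsBranchA q → IsCentralConfiguration A m q → IsTypeA2 q ∨ IsTypeA4 q) ∧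
    (∀ A : ℝ, 2 ≤ A → ∃ (m : Fin 5 → ℝ) (q : Config),
      IsBranchA q ∧ IsCentralConfiguration A m q ∧ IsTypeA4 q) ∧
    (∀ A : ℝ, 2 ≤ A → ∃ (m : Fin 5 → ℝ) (q : Config),
      IsBranchA q ∧ IsCentralConfiguration A m q ∧ IsTypeA2 q ∧
        ∀ (m' : Fin 5 → ℝ) (q' : Config),
          IsBranchA q' → IsCentralConfiguration A m' q' → IsTypeA2 q' →
            q' = q ∧ ∃ t : ℝ, 0 < t ∧ m' = t • m) := by
  refine ⟨fun A hA m q hq hcc ↦ ?_, fun A hA ↦ ?_, fun A hA ↦ ?_⟩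
  · obtain ⟨t, ht0, ht, rfl⟩ := (isBranchA_iff q).1 hq
    obtain ⟨htpos, hc, ⟨h3, hZ⟩ | ⟨h3, hZ⟩⟩ := sign_dichotomy (by linarith : 0 < A / 2) ht0 ht hcc.1
      (massEquations_of_central hA ht0 ht hcc)
    · exact Or.inl (typeA2_of_signs htpos hc h3 hZ)
    · exact Or.inr (typeA4_of_signs htpos ht hc h3 hZ)
  · have hk : 1 ≤ A / 2 := by linarith
    have hk0 : 0 < A / 2 := by linarith
    obtain ⟨t, ht0, ht, h3, hc, hZ, hE⟩ := exists_branchEquation_A4 hk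
    obtain ⟨m, hm, hME⟩ := exists_masses ht0 (betaPow_lt_one hk0 (by linarith))
      (gammaPow_lt_one hk0 hc) (mul_pos (by linarith [alphaPow_lt_one hk0 h3]) hZ) hE
    exact ⟨m, _, (isBranchA_iff _).2 ⟨t, ht0.le, ht, rfl⟩,
      central_of_massEquations ht0 ht hZ.ne' hm hME, typeA4_of_signs ht0 ht hc h3 hZ⟩
  · have hk : 1 ≤ A / 2 := by linarith
    have hk0 : 0 < A / 2 := by linarith
    obtain ⟨t, ht0, h3, hc, hZ, hE⟩ := exists_branchEquation_A2 hk
    have ht : t ^ 2 ≤ 15 := by linarith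
    have hpZ : 0 < (1 - alphaPow (A / 2) t) * branchZ t :=
      mul_pos_of_neg_of_neg (by linarith [alphaPow_gt_one hk0 h3]) hZ
    obtain ⟨m, hm, hME⟩ := exists_masses ht0 (betaPow_lt_one hk0 (by linarith))
      (gammaPow_lt_one hk0 hc) hpZ hE
    refine ⟨m, _, (isBranchA_iff _).2 ⟨t, ht0.le, ht, rfl⟩,
      central_of_massEquations ht0 ht hZ.ne hm hME, typeA2_of_signs ht0 hc h3 hZ, ?_⟩
    intro m' q' hq' hcc' hA2
    obtain ⟨t', ht0', ht', rfl⟩ := (isBranchA_iff q').1 hq'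
    have hME' := massEquations_of_central hA ht0' ht' hcc'
    obtain ⟨htpos, hc', ⟨h3', hZ'⟩ | ⟨h3', hZ'⟩⟩ := sign_dichotomy hk0 ht0' ht' hcc'.1 hME'
    · have htt : t' = t := branchEquation_A2_unique hk htpos ht0 h3' h3 hc' hc hZ' hZ
        (branchEquation_of_masses hcc'.1 hME') hE
      subst htt
      exact ⟨rfl, masses_unique ht0 hpZ.ne' hm hcc'.1 hME hME'⟩
    · have h023 := hA2.2.1
      rw [orientedArea_023] at h023
      linarith
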